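/- Let $\Bbbk$ be a nonzero commutative ring and let $n\geq 2$. Let $\Gamma$ be the repetitive quiver of $\vec{\mathbb A}_n = (1\xrightarrow{a_1}2\xrightarrow{a_2}\cdots\xrightarrow{a_{n-1}}n)$: its vertices are the pairs $(q,i)$ with $1\leq q\leq n$ and $i\in\mathbb Z$, and its arrows are $a_{q,i}\colon (q,i)\to(q+1,i)$ and $a^*_{q,i}\colon (q+1,i)\to(q,i-1)$ for $1\leq q<n$ and $i\in\mathbb Z$. It is a stable translation quiver with translation $\tau(q,i)=(q,i+1)$ and semitranslation $\sigma(a_{q,i})=a^*_{q,i+1}$, $\sigma(a^*_{q,i})=a_{q,i}$. Let $Q$ be its mesh category over $\Bbbk$, i.e. the quotient of the path category $\Bbbk\Gamma$ (whose hom-modules are free on the paths) by the two-sided ideal generated by the mesh relations $\mu_v=\sum_{a} a\,\sigma(a)\colon\tau(v)\to v$, where $v$ is a vertex and $a$ runs over all arrows with target $v$. Let $\mathfrak r$ be the arrow ideal, i.e. the two-sided ideal of $Q$ generated by all arrows. Then the following hold. (0) $Q$ is Hom-finite (every $Q(u,v)$ is a finitely generated projective $\Bbbk$-module), locally bounded (for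 every object $v$ only finitely many objects $u$ satisfy $Q(u,v)\neq 0$ and only finitely many satisfy $Q(v,u)\neq 0$), and has the Strong Retraction Property: for every object $v$ the map $\Bbbk\to Q(v,v)$, $x\mapsto x\cdot\mathrm{id}_v$, has a $\Bbbk$-linear retraction, and there are $\Bbbk$-submodules $\mathfrak r_v\subseteq Q(v,v)$ with $Q(v,v)=(\Bbbk\cdot\mathrm{id}_v)\oplus\mathfrak r_v$ such that $\mathfrak r_v\circ\mathfrak r_v\subseteq\mathfrak r_v$ for all $v$ and $Q(v,u)\circ Q(u,v)\subseteq\mathfrak r_u$ for all $u\neq v$. (a) Each $Q((p,i),(q,j))$ is either zero or free of rank $1$ over $\Bbbk$. The latter happens if and only if $(q,j)$ lies in, or on the boundary of, the rectangle $R_{p,i}$ spanned by $(p,i)$, $(1,i+1-p)$, $(n,i)$ and $(n+1-p,i+1-p)$, where $\Gamma$ is drawn in the plane with $(q,j)$ at the point $(q-2j,-q)$. (For $p=1$ and $p=n$ the rectangle degenerates to a line segment.) (b) There is a unique $\Bbbk$-linear functor $\mathbb S\colon Q\to Q$ with $\mathbb S(q,i)=(n+1-q,\,i+1-q)$ on objects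 and $\mathbb S(a_{q,i})=(-1)^q a^*_{n-q,\,i+1-q}$, $\mathbb S(a^*_{q,i})=(-1)^{n-q}a_{n-q,\,i-q}$ on arrows. It is a Serre functor relative to $\Bbbk$, i.e. an autoequivalence for which there are $\Bbbk$-linear isomorphisms $Q(u,v)\cong\operatorname{Hom}_\Bbbk(Q(v,\mathbb S(u)),\Bbbk)$ natural in $u$ and $v$. (c) The arrow ideal $\mathfrak r$ is the pseudo-radical of $Q$, i.e. the submodules $\mathfrak r_v=\mathfrak r(v,v)$ satisfy the requirements of the Strong Retraction Property and $\mathfrak r(u,v)=Q(u,v)$ for $u\neq v$. It is nilpotent; in fact $\mathfrak r^n=0$. -/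

import Mathlib

open CategoryTheory

universe w v u

/-! ### Two-sided ideals in `k`-linear categories and quotient categories -/

/-- A two-sided ideal in a `k`-linear category: a submodule of every hom-module, stable under
composition with arbitrary morphisms on both sides. -/
@[ext]
structure CatIdeal (k : Type w) [CommRing k] (C : Type u) [Category.{v} C] [Preadditive C]
    [Linear k C] where
  hom : ∀ X Y : C, Submodule k (X ⟶ Y)
  comp_left : ∀ {X Y Z : C} (f : X ⟶ Y) {g : Y ⟶ Z}, g ∈ hom Y Z → f ≫ g ∈ hom X Z
  comp_right : ∀ {X Y Z : C} {f : X ⟶ Y} (g : Y ⟶ Z), f ∈ hom X Y → f ≫ g ∈ hom X Z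

namespace CatIdeal

variable {k : Type w} [CommRing k] {C : Type u} [Category.{v} C] [Preadditive C] [Linear k C]

/-- The ideal generated by a family `S` of morphisms: in each hom-module, the submodule spanned
by all composites `f ≫ s ≫ g` with `s` in `S`. -/
def generate (k : Type w) [CommRing k] {C : Type u} [Category.{v} C] [Preadditive C] [Linear k C]
    (S : ∀ X Y : C, Set (X ⟶ Y)) : CatIdeal k C where
  hom X Y := Submodule.span k
    {h | ∃ (X' Y' : C) (f : X ⟶ X') (s : X' ⟶ Y') (g : Y' ⟶ Y), s ∈ S X' Y' ∧ h = f ≫ s ≫ g}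
  comp_left {X Y Z} f {g} hg := by
    refine Submodule.span_induction (p := fun g _ => f ≫ g ∈ _) ?_ ?_ ?_ ?_ hg
    · rintro _ ⟨X', Y', a, s, b, hs, rfl⟩
      exact Submodule.subset_span ⟨X', Y', f ≫ a, s, b, hs, by simp⟩
    · simp
    · intro x y _ _ hx hy
      rw [Preadditive.comp_add]
      exact Submodule.add_mem _ hx hy
    · intro a x _ hx
      rw [Linear.comp_smul]
      exact Submodule.smul_mem _ a hx
  comp_right {X Y Z} {f} g hf := by
    refine Submodule.span_induction (p := fun f _ => f ≫ g ∈ _) ?_ ?_ ?_ ?_ hf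
    · rintro _ ⟨X', Y', a, s, b, hs, rfl⟩
      exact Submodule.subset_span ⟨X', Y', a, s, b ≫ g, hs, by simp⟩
    · simp
    · intro x y _ _ hx hy
      rw [Preadditive.add_comp]
      exact Submodule.add_mem _ hx hy
    · intro a x _ hx
      rw [Linear.smul_comp]
      exact Submodule.smul_mem _ a hx

/-- The product of two ideals, generated by the composites of their morphisms. -/
def mul (I J : CatIdeal k C) : CatIdeal k C :=
  generate k fun X Z => {h | ∃ (Y : C) (f : X ⟶ Y) (g : Y ⟶ Z),
    f ∈ I.hom X Y ∧ g ∈ J.hom Y Z ∧ h = f ≫ g}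

/-- The unit ideal, consisting of all morphisms. -/
def unit (k : Type w) [CommRing k] (C : Type u) [Category.{v} C] [Preadditive C] [Linear k C] :
    CatIdeal k C where
  hom _ _ := ⊤
  comp_left _ _ _ := trivial
  comp_right _ _ := trivial

/-- The powers of an ideal; the zeroth power is the unit ideal. -/
def pow (I : CatIdeal k C) : ℕ → CatIdeal k C
  | 0 => unit k C
  | l + 1 => (I.pow l).mul I

/-- An ideal is zero if it contains only zero morphisms. -/
def IsZero (I : CatIdeal k C) : Prop :=
  ∀ (X Y : C), I.hom X Y = ⊥

/-- The congruence modulo an ideal. -/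
def rel (I : CatIdeal k C) : HomRel C := fun X Y f g => f - g ∈ I.hom X Y

instance (I : CatIdeal k C) : Congruence I.rel where
  comp_left {_ _ _} f {g g'} h := by
    have := I.comp_left f h
    rwa [Preadditive.comp_sub] at this
  comp_right {_ _ _} {f f'} g h := by
    have := I.comp_right g h
    rwa [Preadditive.sub_comp] at this
  equivalence {X Y} :=
    { refl := fun f => by simp [rel]
      symm := fun {f g} h => by simpa [rel] using (I.hom X Y).neg_mem h
      trans := fun {f g e} h h' => by simpa [rel] using (I.hom X Y).add_mem h h' }

/-- The quotient `C / I` of a `k`-linear category by an ideal. -/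
abbrev QuotientCat (I : CatIdeal k C) := CategoryTheory.Quotient I.rel

instance (I : CatIdeal k C) : Preadditive I.QuotientCat :=
  Quotient.preadditive I.rel fun X Y f₁ f₂ g₁ g₂ h h' => by
    have := (I.hom X Y).add_mem h h'
    simpa [rel, add_sub_add_comm] using this

instance (I : CatIdeal k C) : (Quotient.functor I.rel).Additive where
  map_add := rfl

instance (I : CatIdeal k C) : Linear k I.QuotientCat :=
  Quotient.linear k I.rel fun a X Y f₁ f₂ h => by
    have := (I.hom X Y).smul_mem a h
    simpa [rel, smul_sub] using this

end CatIdeal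

/-! ### Conditions on a `k`-linear category -/

section Conditions

variable (k : Type w) [CommRing k] (C : Type u) [Category.{v} C] [Preadditive C] [Linear k C]

/-- Hom-finiteness: every hom-module is finitely generated and projective. -/
def HomFinite : Prop :=
  ∀ X Y : C, Module.Finite k (X ⟶ Y) ∧ Module.Projective k (X ⟶ Y)

/-- Local boundedness: only finitely many objects map nontrivially into or out of an object. -/
def LocallyBounded (C : Type u) [Category.{v} C] [Preadditive C] : Prop :=
  ∀ q : C, {p : C | ∃ f : p ⟶ q, f ≠ 0}.Finite ∧ {r : C | ∃ f : q ⟶ r, f ≠ 0}.Finite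

variable {C}

/-- `S` is a Serre functor relative to `k`: a `k`-linear autoequivalence together with
`k`-linear isomorphisms `C(p, q) ≅ Hom_k(C(q, S p), k)` that are natural in `p` and `q`. -/
structure IsSerreFunctor (S : C ⥤ C) : Prop where
  additive : S.Additive
  linear : S.Linear k
  isEquivalence : S.IsEquivalence
  exists_natIso : ∃ e : ∀ p q : C, (p ⟶ q) ≃ₗ[k] Module.Dual k (q ⟶ S.obj p),
    (∀ {p q q' : C} (f : p ⟶ q) (b : q ⟶ q') (g : q' ⟶ S.obj p),
      e p q' (f ≫ b) g = e p q f (b ≫ g)) ∧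
    (∀ {p' p q : C} (a : p' ⟶ p) (f : p ⟶ q) (g : q ⟶ S.obj p'),
      e p' q (a ≫ f) g = e p q f (g ≫ S.map a))

/-- A family `r` of submodules `r q` of the endomorphism modules witnesses the Strong Retraction
Property. -/
structure IsStrongRetractionFamily (r : ∀ q : C, Submodule k (q ⟶ q)) : Prop where
  exists_retraction : ∀ q : C, ∃ t : (q ⟶ q) →ₗ[k] k, ∀ x : k, t (x • 𝟙 q) = x
  isCompl : ∀ q : C, IsCompl (Submodule.span k {𝟙 q}) (r q)
  comp_mem : ∀ (q : C) (f g : q ⟶ q), f ∈ r q → g ∈ r q → f ≫ g ∈ r q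
  comp_mem_of_ne : ∀ (p q : C), p ≠ q → ∀ (f : p ⟶ q) (g : q ⟶ p), f ≫ g ∈ r p

variable (C) in
/-- The Strong Retraction Property. -/
def StrongRetractionProperty : Prop :=
  ∃ r : ∀ q : C, Submodule k (q ⟶ q), IsStrongRetractionFamily k r

variable {k} in
/-- `I` is the pseudo-radical belonging to a strong retraction family: its endomorphism parts
form such a family and it contains every morphism between distinct objects. -/
def IsPseudoRadical (I : CatIdeal k C) : Prop :=
  IsStrongRetractionFamily k (fun q => I.hom q q) ∧ ∀ p q : C, p ≠ q → I.hom p q = ⊤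

end Conditions

/-! ### Stable translation quivers and mesh categories -/

/-- A (locally finite) stable translation quiver. As the translation `tr` is a bijection, a
bijection of the set of all arrows that sends each `p ⟶ q` to an arrow `tr q ⟶ p` is the same
thing as a family of bijections `str` between these sets of arrows. -/
class StableTranslationQuiver (V : Type u) [Quiver.{v} V] where
  tr : V ≃ V
  str : ∀ {p q : V}, (p ⟶ q) ≃ (tr q ⟶ p)
  finite_into : ∀ q : V, Finite (Σ p : V, p ⟶ q)

section Mesh

variable (k : Type w) [CommRing k] (V : Type u) [Quiver.{v} V]

/-- The path category of a quiver over `k`: hom-modules are free on the paths. -/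
abbrev PathCat := Free k (Paths V)

variable {V}

/-- A vertex as an object of the path category. -/
noncomputable abbrev PathCat.vertex (q : V) : PathCat k V :=
  (Free.embedding k (Paths V)).obj ((Paths.of V).obj q)

/-- An arrow as a morphism of the path category. -/
noncomputable abbrev PathCat.arrow {p q : V} (a : p ⟶ q) : PathCat.vertex k p ⟶ PathCat.vertex k q :=
  (Free.embedding k (Paths V)).map ((Paths.of V).map a)

variable [StableTranslationQuiver V]

/-- The mesh relation at `q`: the sum over all arrows `a` with target `q` of the path that runs
first through `str a` and then through `a`. -/
noncomputable def meshRelation (q : V) :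
    PathCat.vertex k (StableTranslationQuiver.tr q) ⟶ PathCat.vertex k q :=
  ∑ᶠ a : (Σ p : V, p ⟶ q),
    PathCat.arrow k (StableTranslationQuiver.str a.2) ≫ PathCat.arrow k a.2

/-- The morphisms of the path category that are mesh relations. -/
inductive IsMeshRelation : ∀ X Y : PathCat k V, (X ⟶ Y) → Prop
  | mk (q : V) : IsMeshRelation _ _ (meshRelation k q)

variable (V)

/-- The mesh ideal. -/
noncomputable def meshIdeal : CatIdeal k (PathCat k V) :=
  CatIdeal.generate k fun X Y => {f | IsMeshRelation k X Y f}

/-- The mesh category. -/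
abbrev MeshCat := (meshIdeal k V).QuotientCat

variable {V}

/-- A vertex as an object of the mesh category. -/
noncomputable abbrev MeshCat.vertex (q : V) : MeshCat k V :=
  (Quotient.functor (meshIdeal k V).rel).obj (PathCat.vertex k q)

/-- An arrow as a morphism of the mesh category. -/
noncomputable abbrev MeshCat.arrow {p q : V} (a : p ⟶ q) : MeshCat.vertex k p ⟶ MeshCat.vertex k q :=
  (Quotient.functor (meshIdeal k V).rel).map (PathCat.arrow k a)

/-- The morphisms of the mesh category that are given by arrows. -/
inductive IsArrow : ∀ X Y : MeshCat k V, (X ⟶ Y) → Prop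
  | mk {p q : V} (a : p ⟶ q) : IsArrow _ _ (MeshCat.arrow k a)

variable (V)

/-- The arrow ideal of the mesh category. -/
noncomputable def arrowIdeal : CatIdeal k (MeshCat k V) :=
  CatIdeal.generate k fun X Y => {f | IsArrow k X Y f}

end Mesh

/-! ### Repetitive quivers -/

/-- The vertices `(p, i)` of the repetitive quiver of `D`. -/
@[ext]
structure RepQuiver (D : Type u) where
  pt : D
  lvl : ℤ

/-- The arrows of the repetitive quiver of `D`: for `x : p ⟶ q` in `D` the arrows
`xᵢ : (p, i) ⟶ (q, i)` and `xᵢ* : (q, i) ⟶ (p, i - 1)`. -/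
inductive RepHom {D : Type u} [Quiver.{v} D] (a b : RepQuiver D) : Type v
  | arr (x : a.pt ⟶ b.pt) (h : a.lvl = b.lvl) : RepHom a b
  | star (x : b.pt ⟶ a.pt) (h : b.lvl = a.lvl - 1) : RepHom a b

namespace RepQuiver

variable {D : Type u} [Quiver.{v} D]

instance : Quiver.{v} (RepQuiver D) where
  Hom a b := RepHom a b

/-- The translation `(q, i) ↦ (q, i + 1)`. -/
def tr : RepQuiver D ≃ RepQuiver D where
  toFun a := ⟨a.pt, a.lvl + 1⟩
  invFun a := ⟨a.pt, a.lvl - 1⟩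
  left_inv a := by ext <;> simp
  right_inv a := by ext <;> simp

/-- The semitranslation `xᵢ ↦ xᵢ₊₁*`, `xᵢ* ↦ xᵢ`. -/
def str {a b : RepQuiver D} : RepHom a b ≃ RepHom (tr b) a where
  toFun
    | .arr x h => .star x (by simp [tr, h])
    | .star x h => .arr x (by simp [tr, h])
  invFun
    | .arr x h => .star x (by simp [tr] at h; omega)
    | .star x h => .arr x (by simp [tr] at h; omega)
  left_inv := by rintro (_ | _) <;> rfl
  right_inv := by rintro (_ | _) <;> rfl

instance [∀ q : D, Finite (Σ p : D, p ⟶ q)] [∀ p : D, Finite (Σ q : D, p ⟶ q)] :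
    StableTranslationQuiver (RepQuiver D) where
  tr := tr
  str := str
  finite_into b := by
    let F : (Σ a : RepQuiver D, a ⟶ b) → (Σ p : D, p ⟶ b.pt) ⊕ (Σ q : D, b.pt ⟶ q)
      | ⟨a, .arr x _⟩ => .inl ⟨a.pt, x⟩
      | ⟨a, .star x _⟩ => .inr ⟨a.pt, x⟩
    refine Finite.of_injective F ?_
    rintro ⟨⟨p, i⟩, x | x⟩ ⟨⟨q, j⟩, y | y⟩ h
    · simp only [F, Sum.inl.injEq, Sigma.mk.injEq] at h
      obtain ⟨rfl, h⟩ := h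
      obtain rfl : i = j := by simp_all
      cases h
      rfl
    · simp [F] at h
    · simp [F] at h
    · simp only [F, Sum.inr.injEq, Sigma.mk.injEq] at h
      obtain ⟨rfl, h⟩ := h
      obtain rfl : i = j := by simp_all
      cases h
      rfl

end RepQuiver

/-! ### The quiver `1 ⟶ 2 ⟶ ⋯ ⟶ n` -/

/-- The vertices `1, …, n` of the linearly oriented quiver of type `A`. -/
@[ext]
structure LinA (n : ℕ) where
  val : ℕ
  one_le : 1 ≤ val
  le : val ≤ n

namespace LinA

variable {n : ℕ}

/-- There is exactly one arrow `a_q : q ⟶ q + 1` for `1 ≤ q < n`, and no other arrow. -/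
instance : Quiver.{0} (LinA n) where
  Hom p q := PLift (p.val + 1 = q.val)

instance (q : LinA n) : Finite (Σ p : LinA n, p ⟶ q) := by
  refine @Finite.of_subsingleton _ ⟨?_⟩
  rintro ⟨p, ⟨h⟩⟩ ⟨p', ⟨h'⟩⟩
  obtain rfl : p = p' := by ext; omega
  rfl

instance (p : LinA n) : Finite (Σ q : LinA n, p ⟶ q) := by
  refine @Finite.of_subsingleton _ ⟨?_⟩
  rintro ⟨q, ⟨h⟩⟩ ⟨q', ⟨h'⟩⟩
  obtain rfl : q = q' := by ext; omega
  rfl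

/-- The vertex `n + 1 - q`. -/
def refl (q : LinA n) : LinA n where
  val := n + 1 - q.val
  one_le := by have := q.le; omega
  le := by have := q.one_le; omega

/-- The arrow `a_{n - q} : n - q ⟶ n + 1 - q` attached to `a_q : q ⟶ q + 1`. -/
def reflArrow {p q : LinA n} (x : p ⟶ q) : q.refl ⟶ p.refl :=
  ⟨by have := x.down; have := q.le; simp only [refl]; omega⟩

end LinA

/-- The mesh category over `k` of the repetitive quiver of `1 ⟶ 2 ⟶ ⋯ ⟶ n`. -/
abbrev MeshRepA (k : Type w) [CommRing k] (n : ℕ) := MeshCat k (RepQuiver (LinA n))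

/-- The position at which the vertex `(q, j)` is drawn in the plane: an arrow
`(q, j) ⟶ (q + 1, j)` goes one step to the right and one step down, and an arrow
`(q + 1, j) ⟶ (q, j - 1)` goes one step to the right and one step up. -/
def drawnAt (q j : ℤ) : ℝ × ℝ := ((q - 2 * j : ℤ), (-q : ℤ))

/-- The rectangle spanned by `(p, i)`, `(1, i + 1 - p)`, `(n, i)` and
`(n + 1 - p, i + 1 - p)`, including its interior and its boundary. -/
def rectangle (n p i : ℤ) : Set (ℝ × ℝ) :=
  convexHull ℝ {drawnAt p i, drawnAt 1 (i + 1 - p), drawnAt n i,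
    drawnAt (n + 1 - p) (i + 1 - p)}

/-- The map `(q, i) ↦ (n + 1 - q, i + 1 - q)` on vertices. -/
def serreVertex {n : ℕ} (a : RepQuiver (LinA n)) : RepQuiver (LinA n) where
  pt := a.pt.refl
  lvl := a.lvl + 1 - a.pt.val

/-- The image `a*_{n - q, i + 1 - q}` (without the sign) of the arrow `a_{q, i}`. -/
def serreArr {n : ℕ} {a b : RepQuiver (LinA n)} (x : a.pt ⟶ b.pt) (h : a.lvl = b.lvl) :
    serreVertex a ⟶ serreVertex b :=
  RepHom.star (LinA.reflArrow x) (by have := x.down; simp only [serreVertex]; omega)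

/-- The image `a_{n - q, i - q}` (without the sign) of the arrow `a*_{q, i}`. -/
def serreStar {n : ℕ} {a b : RepQuiver (LinA n)} (x : b.pt ⟶ a.pt) (h : b.lvl = a.lvl - 1) :
    serreVertex a ⟶ serreVertex b :=
  RepHom.arr (LinA.reflArrow x) (by have := x.down; simp only [serreVertex]; omega)

/-- The endofunctor `S` is given on vertices by `(q, i) ↦ (n + 1 - q, i + 1 - q)` and on arrows
by `a_{q, i} ↦ (-1)^q a*_{n - q, i + 1 - q}` and `a*_{q, i} ↦ (-1)^(n - q) a_{n - q, i - q}`. -/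
structure IsGivenBySerreFormulas (k : Type w) [CommRing k] {n : ℕ}
    (S : MeshRepA k n ⥤ MeshRepA k n) : Prop where
  obj_eq : ∀ a : RepQuiver (LinA n), S.obj (MeshCat.vertex k a) = MeshCat.vertex k (serreVertex a)
  map_arr : ∀ {a b : RepQuiver (LinA n)} (x : a.pt ⟶ b.pt) (h : a.lvl = b.lvl),
    S.map (MeshCat.arrow k (RepHom.arr x h : a ⟶ b)) =
      eqToHom (obj_eq a) ≫ ((-1 : k) ^ a.pt.val • MeshCat.arrow k (serreArr x h)) ≫
        eqToHom (obj_eq b).symm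
  map_star : ∀ {a b : RepQuiver (LinA n)} (x : b.pt ⟶ a.pt) (h : b.lvl = a.lvl - 1),
    S.map (MeshCat.arrow k (RepHom.star x h : a ⟶ b)) =
      eqToHom (obj_eq a) ≫ ((-1 : k) ^ (n - b.pt.val) • MeshCat.arrow k (serreStar x h)) ≫
        eqToHom (obj_eq b).symm

/-! Put x = q - j and y = -j for a vertex (q, j). Then Γ is the strip 1 ≤ x - y ≤ n of the grid ℤ²,
and every arrow is a unit step in x (`down`) or in y (`up`). The signs `arrowSign` turn the meshes
into commuting squares (`signedArrow_comm`). At the border of the strip a mesh has only one summand,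
so the remaining composite is zero.

By induction on the length x + y, all signed paths with the same endpoints agree, since two paths
ending in different arrows can both be rerouted through τ(b) and compared across one square. A path
that leaves the rectangle can be pushed to the border, where it dies. Both facts are `coherent`.
Conversely, the signed sum of coefficients `signSum` kills the mesh ideal inside a rectangle,
because only meshes with both summands occur there (`signSum_eq_zero_of_mem`). So `coeff` identifies
Q(a, b) with 𝕜 inside the rectangle of a, and Q(a, b) = 0 outside. Inside rectangles composition is
multiplication of coefficients (`coeff_comp`).

The remaining claims can be read off this description. Rectangles are finite, endomorphism modules
are 𝕜 · id, so the arrow ideal has zero endomorphism part, and a nonzero morphism has length at most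
n - 1, which gives 𝔯ⁿ = 0. The object 𝕊(a) is the corner opposite to a, so b lies in the rectangle
of a iff 𝕊(a) lies in that of b. Hence composing into Q(a, 𝕊(a)) ≅ 𝕜 is a perfect pairing. It is
natural once the isomorphism is corrected by `traceSign`, whose coboundary is the sign by which 𝕊
changes coefficients (`coeff_serreMap`). -/

namespace PathCat

/-! ### Linear functors out of the path category -/

section

variable {k : Type w} [CommRing k] {V : Type u} [Quiver.{v} V]

variable (k) in
/-- A path as a morphism of the path category. -/
noncomputable def pathHom {a b : V} (p : Quiver.Path a b) : vertex k a ⟶ vertex k b :=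
  (Free.embedding k (Paths V)).map (show (Paths.of V).obj a ⟶ (Paths.of V).obj b from p)

theorem pathHom_nil (a : V) : pathHom k (Quiver.Path.nil : Quiver.Path a a) = 𝟙 _ :=
  (Free.embedding k (Paths V)).map_id _

theorem pathHom_comp {a b c : V} (p : Quiver.Path a b) (q : Quiver.Path b c) :
    pathHom k (p.comp q) = pathHom k p ≫ pathHom k q :=
  (Free.embedding k (Paths V)).map_comp (X := (Paths.of V).obj a) (Y := (Paths.of V).obj b)
    (Z := (Paths.of V).obj c) p q

theorem pathHom_cons {a b c : V} (p : Quiver.Path a b) (e : b ⟶ c) :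
    pathHom k (p.cons e) = pathHom k p ≫ arrow k e :=
  pathHom_comp p e.toPath

theorem hom_induction {a b : V} {P : (vertex k a ⟶ vertex k b) → Prop} (zero : P 0)
    (add : ∀ f g, P f → P g → P (f + g)) (smul : ∀ (c : k) f, P f → P (c • f))
    (path : ∀ p : Quiver.Path a b, P (pathHom k p)) (f : vertex k a ⟶ vertex k b) : P f := by
  have key : ∀ f : Quiver.Path a b →₀ k, P f := by
    intro f
    induction f using Finsupp.induction_linear with
    | zero => exact zero
    | add f g hf hg => exact add f g hf hg
    | single p c =>
      have h := smul c _ (path p)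
      have e : (Finsupp.single p c : Quiver.Path a b →₀ k) = c • Finsupp.single p 1 := by simp
      rw [e]
      exact h
  exact key f

/-- The `k`-linear extension of a function on the paths from `a` to `b`. -/
noncomputable def linearExtension {M : Type*} [AddCommGroup M] [Module k M] {a b : V}
    (F : Quiver.Path a b → M) : (vertex k a ⟶ vertex k b) →ₗ[k] M :=
  Finsupp.linearCombination (α := Quiver.Path a b) k F

theorem linearExtension_pathHom {M : Type*} [AddCommGroup M] [Module k M] {a b : V}
    (F : Quiver.Path a b → M) (p : Quiver.Path a b) : linearExtension F (pathHom k p) = F p := by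
  have := Finsupp.linearCombination_single k (v := F) 1 p
  rw [one_smul] at this
  exact this

/-- Both sides are bilinear in the two factors and paths span, so multiplicativity need only be
checked on paths. This serves both `mapHom` and `signSum`. -/
theorem comp_eq_of_path {a b c : V} {M : Type*} [AddCommGroup M] [Module k M]
    (L : (vertex k a ⟶ vertex k c) →ₗ[k] M)
    (B : (vertex k a ⟶ vertex k b) →ₗ[k] (vertex k b ⟶ vertex k c) →ₗ[k] M)
    (h : ∀ p q, L (pathHom k p ≫ pathHom k q) = B (pathHom k p) (pathHom k q))
    (f : vertex k a ⟶ vertex k b) (g : vertex k b ⟶ vertex k c) : L (f ≫ g) = B f g := by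
  induction f using hom_induction with
  | zero => simp
  | add f f' hf hf' => simp [hf, hf']
  | smul x f hf => simp [hf]
  | path p =>
    induction g using hom_induction with
    | zero => simp
    | add f f' hf hf' => simp [hf, hf']
    | smul x f hf => simp [hf]
    | path q => exact h p q

variable {D : Type*} [Category D] (φ : V ⥤q D)

/-- The composite of the images of the arrows of a path. -/
def mapPath {a b : V} (p : Quiver.Path a b) : φ.obj a ⟶ φ.obj b :=
  (Paths.lift φ).map (show (Paths.of V).obj a ⟶ (Paths.of V).obj b from p)

theorem mapPath_comp {a b c : V} (p : Quiver.Path a b) (q : Quiver.Path b c) :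
    mapPath φ (p.comp q) = mapPath φ p ≫ mapPath φ q :=
  (Paths.lift φ).map_comp (X := (Paths.of V).obj a) (Y := (Paths.of V).obj b)
    (Z := (Paths.of V).obj c) p q

theorem mapPath_toPath {a b : V} (e : a ⟶ b) : mapPath φ e.toPath = φ.map e :=
  Category.id_comp _

variable [Preadditive D] [Linear k D]

/-- The `k`-linear extension of `mapPath`. -/
noncomputable def mapHom {a b : V} : (vertex k a ⟶ vertex k b) →ₗ[k] (φ.obj a ⟶ φ.obj b) :=
  linearExtension (mapPath φ)

theorem mapHom_pathHom {a b : V} (p : Quiver.Path a b) :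
    mapHom φ (pathHom k p) = mapPath φ p :=
  linearExtension_pathHom _ p

theorem mapHom_id (a : V) : mapHom φ (𝟙 (vertex k a)) = 𝟙 _ := by
  rw [← pathHom_nil, mapHom_pathHom]
  rfl

theorem mapHom_comp {a b c : V} (f : vertex k a ⟶ vertex k b) (g : vertex k b ⟶ vertex k c) :
    mapHom φ (f ≫ g) = mapHom φ f ≫ mapHom φ g := by
  refine comp_eq_of_path _ (((Linear.comp (S := k) (φ.obj a) (φ.obj b) (φ.obj c)).compl₂
    (mapHom φ)).comp (mapHom φ)) (fun p q => ?_) f g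
  rw [← pathHom_comp, mapHom_pathHom, mapPath_comp, ← mapHom_pathHom (k := k),
    ← mapHom_pathHom (k := k)]
  rfl

/-- The `k`-linear functor on the path category determined by a map of quivers. -/
noncomputable def lift : PathCat k V ⥤ D where
  obj a := φ.obj a
  map {a b} f := mapHom φ (a := a) (b := b) f
  map_id a := mapHom_id φ a
  map_comp {a b c} f g := mapHom_comp φ (a := a) (b := b) (c := c) f g

theorem lift_map_arrow {a b : V} (e : a ⟶ b) :
    (lift (k := k) φ).map (arrow k e) = φ.map e :=
  (mapHom_pathHom φ e.toPath).trans (mapPath_toPath φ e)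

instance : (lift (k := k) φ).Additive where
  map_add {a b} f g := by
    have h := map_add (mapHom (k := k) φ (a := a) (b := b)) f g
    exact h

instance : (lift (k := k) φ).Linear k where
  map_smul {a b} f r := by
    have h := map_smul (mapHom (k := k) φ (a := a) (b := b)) r f
    exact h

end

end PathCat

/-! ### Linear maps out of a quotient by an ideal -/

namespace CatIdeal

variable {k : Type w} [CommRing k] {C : Type u} [Category.{v} C] [Preadditive C] [Linear k C]

instance (I : CatIdeal k C) : (Quotient.functor I.rel).Linear k where
  map_smul _ _ := rfl

/-- The functor to the quotient category. -/
abbrev proj (I : CatIdeal k C) : C ⥤ I.QuotientCat := Quotient.functor I.rel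

theorem proj_map_eq_iff (I : CatIdeal k C) {X Y : C} (f g : X ⟶ Y) :
    I.proj.map f = I.proj.map g ↔ f - g ∈ I.hom X Y :=
  Quotient.functor_map_eq_iff I.rel f g

theorem proj_map_eq_zero_iff (I : CatIdeal k C) {X Y : C} (f : X ⟶ Y) :
    I.proj.map f = 0 ↔ f ∈ I.hom X Y := by
  rw [← I.proj.map_zero, proj_map_eq_iff, sub_zero]

/-- A linear map that vanishes on an ideal descends to the quotient category. -/
noncomputable def descend (I : CatIdeal k C) {X Y : C} {M : Type*} [AddCommGroup M] [Module k M]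
    (L : (X ⟶ Y) →ₗ[k] M) (hL : ∀ f ∈ I.hom X Y, L f = 0) :
    (I.proj.obj X ⟶ I.proj.obj Y) →ₗ[k] M :=
  have key : ∀ f g : X ⟶ Y, I.proj.map f = I.proj.map g → L f = L g := fun f g h => by
    rw [← sub_eq_zero, ← map_sub]
    exact hL _ ((I.proj_map_eq_iff f g).1 h)
  -- The value on a chosen preimage; `key` makes the choice irrelevant, which gives linearity.
  { toFun := fun f => L (Function.surjInv I.proj.map_surjective f)
    map_add' := fun f g => by
      rw [← map_add]
      apply key
      rw [Functor.map_add, Function.surjInv_eq I.proj.map_surjective,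
        Function.surjInv_eq I.proj.map_surjective, Function.surjInv_eq I.proj.map_surjective]
    map_smul' := fun c f => by
      rw [RingHom.id_apply, ← map_smul]
      apply key
      rw [Functor.map_smul, Function.surjInv_eq I.proj.map_surjective,
        Function.surjInv_eq I.proj.map_surjective] }

theorem descend_proj_map (I : CatIdeal k C) {X Y : C} {M : Type*} [AddCommGroup M] [Module k M]
    (L : (X ⟶ Y) →ₗ[k] M) (hL : ∀ f ∈ I.hom X Y, L f = 0) (f : X ⟶ Y) :
    I.descend L hL (I.proj.map f) = L f := by
  change L (Function.surjInv I.proj.map_surjective (I.proj.map f)) = L f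
  rw [← sub_eq_zero, ← map_sub]
  refine hL _ ((I.proj_map_eq_iff _ _).1 ?_)
  rw [Function.surjInv_eq I.proj.map_surjective]

theorem generate_induction {S : ∀ X Y : C, Set (X ⟶ Y)} {X Y : C} {P : (X ⟶ Y) → Prop}
    (zero : P 0) (add : ∀ f g, P f → P g → P (f + g)) (smul : ∀ (c : k) f, P f → P (c • f))
    (gen : ∀ (X' Y' : C) (f : X ⟶ X') (s : X' ⟶ Y') (g : Y' ⟶ Y), s ∈ S X' Y' → P (f ≫ s ≫ g))
    {f : X ⟶ Y} (hf : f ∈ (generate k S).hom X Y) : P f := by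
  refine Submodule.span_induction (p := fun f _ => P f) ?_ zero (fun f g _ _ => add f g)
    (fun c f _ => smul c f) hf
  rintro _ ⟨X', Y', f, s, g, hs, rfl⟩
  exact gen _ _ f s g hs

theorem mem_generate {S : ∀ X Y : C, Set (X ⟶ Y)} {X Y : C} {s : X ⟶ Y} (hs : s ∈ S X Y) :
    s ∈ (generate k S).hom X Y :=
  Submodule.subset_span ⟨X, Y, 𝟙 X, s, 𝟙 Y, hs, by simp⟩

end CatIdeal

/-! ### The universal property of a mesh category -/

namespace MeshCat

variable {k : Type w} [CommRing k] {V : Type u} [Quiver.{v} V] [StableTranslationQuiver V]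

variable (k) in
/-- A path as a morphism of the mesh category. -/
noncomputable def pathHom {a b : V} (p : Quiver.Path a b) : vertex k a ⟶ vertex k b :=
  (meshIdeal k V).proj.map (PathCat.pathHom k p)

theorem pathHom_nil (a : V) : pathHom k (Quiver.Path.nil : Quiver.Path a a) = 𝟙 _ := by
  rw [pathHom, PathCat.pathHom_nil, CategoryTheory.Functor.map_id]

theorem pathHom_comp {a b c : V} (p : Quiver.Path a b) (q : Quiver.Path b c) :
    pathHom k (p.comp q) = pathHom k p ≫ pathHom k q := by
  rw [pathHom, PathCat.pathHom_comp, Functor.map_comp]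
  rfl

theorem pathHom_cons {a b c : V} (p : Quiver.Path a b) (e : b ⟶ c) :
    pathHom k (p.cons e) = pathHom k p ≫ arrow k e :=
  pathHom_comp p e.toPath

theorem hom_induction {a b : V} {P : (vertex k a ⟶ vertex k b) → Prop} (zero : P 0)
    (add : ∀ f g, P f → P g → P (f + g)) (smul : ∀ (c : k) f, P f → P (c • f))
    (path : ∀ p : Quiver.Path a b, P (pathHom k p)) (f : vertex k a ⟶ vertex k b) : P f := by
  obtain ⟨f, rfl⟩ := (meshIdeal k V).proj.map_surjective f
  induction f using PathCat.hom_induction with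
  | zero =>
    rw [Functor.map_zero]
    exact zero
  | add f g hf hg =>
    rw [Functor.map_add]
    exact add _ _ hf hg
  | smul c f hf =>
    rw [Functor.map_smul]
    exact smul _ _ hf
  | path p => exact path p

theorem proj_meshRelation (q : V) : (meshIdeal k V).proj.map (meshRelation k q) = 0 :=
  ((meshIdeal k V).proj_map_eq_zero_iff _).2 (CatIdeal.mem_generate (IsMeshRelation.mk q))

section Lift

variable {D : Type*} [Category D] [Preadditive D] [Linear k D] (φ : V ⥤q D)
  (hφ : ∀ q : V, (PathCat.lift φ).map (meshRelation k q) = 0)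

/-- The `k`-linear functor on the mesh category determined by a map of quivers that respects
the mesh relations. -/
noncomputable def lift : MeshCat k V ⥤ D :=
  CategoryTheory.Quotient.lift _ (PathCat.lift φ) (fun X Y f g h => by
    rw [← sub_eq_zero, ← Functor.map_sub]
    refine CatIdeal.generate_induction (P := fun f => (PathCat.lift φ).map f = 0)
      ?_ ?_ ?_ ?_ h
    · exact Functor.map_zero _ _ _
    · intro f g hf hg
      rw [Functor.map_add, hf, hg, add_zero]
    · intro c f hf
      rw [Functor.map_smul, hf, smul_zero]
    · rintro X' Y' f s g ⟨q⟩
      rw [Functor.map_comp, Functor.map_comp, hφ, Limits.zero_comp, Limits.comp_zero])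

theorem lift_map_proj {a b : PathCat k V} (f : a ⟶ b) :
    (lift φ hφ).map ((meshIdeal k V).proj.map f) = (PathCat.lift φ).map f := rfl

instance : (lift φ hφ).Additive where
  map_add {a b} f g := by
    obtain ⟨f, rfl⟩ := (meshIdeal k V).proj.map_surjective f
    obtain ⟨g, rfl⟩ := (meshIdeal k V).proj.map_surjective g
    rw [← Functor.map_add, lift_map_proj, lift_map_proj, lift_map_proj, Functor.map_add]
    rfl

instance : (lift φ hφ).Linear k where
  map_smul {a b} f c := by
    obtain ⟨f, rfl⟩ := (meshIdeal k V).proj.map_surjective f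
    rw [← Functor.map_smul, lift_map_proj, lift_map_proj, Functor.map_smul]
    rfl

end Lift

/-- Two `k`-linear functors on the mesh category that agree on vertices and arrows are equal. -/
theorem functor_ext {D : Type*} [Category D] [Preadditive D] [Linear k D]
    {F G : MeshCat k V ⥤ D} [F.Additive] [F.Linear k] [G.Additive] [G.Linear k]
    (hobj : ∀ a : V, F.obj (vertex k a) = G.obj (vertex k a))
    (hmap : ∀ {a b : V} (e : a ⟶ b), F.map (arrow k e) =
      eqToHom (hobj a) ≫ G.map (arrow k e) ≫ eqToHom (hobj b).symm) : F = G := by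
  refine CategoryTheory.Functor.ext (fun X => hobj X.as) ?_
  -- Every object is definitionally the vertex `X.as`. Restating the goal over vertices makes the
  -- induction over paths applicable.
  suffices h : ∀ (a b : V) (f : vertex k a ⟶ vertex k b),
      F.map f = eqToHom (hobj a) ≫ G.map f ≫ eqToHom (hobj b).symm from
    fun X Y f => h X.as Y.as f
  intro a b f
  induction f using hom_induction with
  | zero => simp
  | add f g hf hg => simp [hf, hg]
  | smul c f hf => simp [hf]
  | path p =>
    induction p with
    | nil => simp [pathHom_nil]
    | cons p e ih => simp [pathHom_cons, ih, hmap]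

end MeshCat

/-! ### Arrows and meshes of the repetitive quiver -/

namespace MeshRepA

variable {k : Type w} [CommRing k] {n : ℕ}

/-- There is at most one arrow between two vertices. -/
instance (a b : RepQuiver (LinA n)) : Subsingleton (a ⟶ b) := by
  refine ⟨?_⟩
  rintro (⟨⟨x⟩, h⟩ | ⟨⟨x⟩, h⟩) (⟨⟨y⟩, h'⟩ | ⟨⟨y⟩, h'⟩)
  · rfl
  · omega
  · omega
  · rfl

/-- The arrow `a_{q, i}` from `a = (q, i)` to `b = (q + 1, i)`. -/
def down {a b : RepQuiver (LinA n)} (h : a.pt.val + 1 = b.pt.val) (h' : a.lvl = b.lvl) : a ⟶ b :=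
  RepHom.arr ⟨h⟩ h'

/-- The arrow `a*_{q, i}` from `a = (q + 1, i)` to `b = (q, i - 1)`. -/
def up {a b : RepQuiver (LinA n)} (h : b.pt.val + 1 = a.pt.val) (h' : b.lvl = a.lvl - 1) : a ⟶ b :=
  RepHom.star ⟨h⟩ h'

theorem arrow_cases {a b : RepQuiver (LinA n)} (e : a ⟶ b) :
    (∃ (h : a.pt.val + 1 = b.pt.val) (h' : a.lvl = b.lvl), e = down h h') ∨
      ∃ (h : b.pt.val + 1 = a.pt.val) (h' : b.lvl = a.lvl - 1), e = up h h' := by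
  rcases e with ⟨⟨x⟩, h⟩ | ⟨⟨x⟩, h⟩
  · exact Or.inl ⟨x, h, rfl⟩
  · exact Or.inr ⟨x, h, rfl⟩

theorem vertex_ext {a b : RepQuiver (LinA n)} (h : a.pt.val = b.pt.val) (h' : a.lvl = b.lvl) :
    a = b :=
  RepQuiver.ext (LinA.ext h) h'

/-- The predecessor `(q + 1, i + 1)` of `b = (q, i)`. -/
def predBelow (b : RepQuiver (LinA n)) (h : b.pt.val < n) : RepQuiver (LinA n) :=
  ⟨⟨b.pt.val + 1, by omega, h⟩, b.lvl + 1⟩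

/-- The predecessor `(q - 1, i)` of `b = (q, i)`. -/
def predAbove (b : RepQuiver (LinA n)) (h : 1 < b.pt.val) : RepQuiver (LinA n) :=
  ⟨⟨b.pt.val - 1, by omega, by have := b.pt.le; omega⟩, b.lvl⟩

theorem tr_pt (b : RepQuiver (LinA n)) : (RepQuiver.tr b).pt = b.pt := rfl

theorem tr_lvl (b : RepQuiver (LinA n)) : (RepQuiver.tr b).lvl = b.lvl + 1 := rfl

theorem predBelow_pt (b : RepQuiver (LinA n)) (h : b.pt.val < n) :
    (predBelow b h).pt.val = b.pt.val + 1 := rfl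

theorem predBelow_lvl (b : RepQuiver (LinA n)) (h : b.pt.val < n) :
    (predBelow b h).lvl = b.lvl + 1 := rfl

theorem predAbove_pt (b : RepQuiver (LinA n)) (h : 1 < b.pt.val) :
    (predAbove b h).pt.val + 1 = b.pt.val := Nat.sub_add_cancel b.pt.one_le

theorem predAbove_lvl (b : RepQuiver (LinA n)) (h : 1 < b.pt.val) :
    (predAbove b h).lvl = b.lvl := rfl

/-- The arrow from `predBelow b` to `b`. -/
def ofPredBelow (b : RepQuiver (LinA n)) (h : b.pt.val < n) : predBelow b h ⟶ b :=
  up (by rw [predBelow_pt]) (by rw [predBelow_lvl]; ring)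

/-- The arrow from `tr b` to `predBelow b`. -/
def toPredBelow (b : RepQuiver (LinA n)) (h : b.pt.val < n) :
    RepQuiver.tr b ⟶ predBelow b h :=
  down (by rw [predBelow_pt, tr_pt]) (by rw [predBelow_lvl, tr_lvl])

/-- The arrow from `predAbove b` to `b`. -/
def ofPredAbove (b : RepQuiver (LinA n)) (h : 1 < b.pt.val) : predAbove b h ⟶ b :=
  down (by rw [predAbove_pt]) (by rw [predAbove_lvl])

/-- The arrow from `tr b` to `predAbove b`. -/
def toPredAbove (b : RepQuiver (LinA n)) (h : 1 < b.pt.val) :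
    RepQuiver.tr b ⟶ predAbove b h :=
  up (by rw [predAbove_pt, tr_pt]) (by rw [predAbove_lvl, tr_lvl]; ring)

variable (k) in
/-- The summand of the mesh relation that runs through `predBelow`. -/
noncomputable def meshBelow (b : RepQuiver (LinA n)) :
    PathCat.vertex k (RepQuiver.tr b) ⟶ PathCat.vertex k b :=
  if h : b.pt.val < n then
    PathCat.arrow k (toPredBelow b h) ≫ PathCat.arrow k (ofPredBelow b h)
  else 0

variable (k) in
/-- The summand of the mesh relation that runs through `predAbove`. -/
noncomputable def meshAbove (b : RepQuiver (LinA n)) :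
    PathCat.vertex k (RepQuiver.tr b) ⟶ PathCat.vertex k b :=
  if h : 1 < b.pt.val then
    PathCat.arrow k (toPredAbove b h) ≫ PathCat.arrow k (ofPredAbove b h)
  else 0

/-- The only possible sources of an arrow into `b` are `predBelow b` and `predAbove b`. Each exists
unless `b` lies on the corresponding border, where the summand is zero by default. -/
theorem meshRelation_eq (b : RepQuiver (LinA n)) :
    meshRelation k b = meshBelow k b + meshAbove k b := by
  classical
  let s : Finset (Σ a : RepQuiver (LinA n), a ⟶ b) :=
    if h : b.pt.val < n then {⟨predBelow b h, ofPredBelow b h⟩} else ∅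
  let t : Finset (Σ a : RepQuiver (LinA n), a ⟶ b) :=
    if h : 1 < b.pt.val then {⟨predAbove b h, ofPredAbove b h⟩} else ∅
  have hst : Disjoint s t := by
    rw [Finset.disjoint_left]
    intro x hx hx'
    simp only [s, t] at hx hx'
    split_ifs at hx hx' <;> simp only [Finset.mem_singleton, Finset.notMem_empty] at hx hx'
    subst hx
    have := congrArg (fun x => x.1.lvl) hx'
    simp [predBelow, predAbove] at this
  rw [meshRelation, finsum_eq_sum_of_support_subset (s := s ∪ t), Finset.sum_union hst]
  · congr 1
    · simp only [s, meshBelow]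
      split_ifs
      · rw [Finset.sum_singleton]
        rfl
      · rfl
    · simp only [t, meshAbove]
      split_ifs
      · rw [Finset.sum_singleton]
        rfl
      · rfl
  · rintro ⟨a, e⟩ -
    rw [Finset.coe_union]
    rcases arrow_cases e with ⟨h, h', -⟩ | ⟨h, h', -⟩
    · right
      have h1 : 1 < b.pt.val := by have := a.pt.one_le; omega
      obtain rfl : a = predAbove b h1 :=
        vertex_ext (by simp only [predAbove]; omega) (by simp only [predAbove]; omega)
      simpa [t, h1] using Subsingleton.elim e _
    · left
      have h1 : b.pt.val < n := by have := a.pt.le; omega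
      obtain rfl : a = predBelow b h1 :=
        vertex_ext (by simp only [predBelow]; omega) (by simp only [predBelow]; omega)
      simpa [s, h1] using Subsingleton.elim e _

/-! ### Signs that make the meshes commute -/

variable (k) in
/-- The sign `(-1) ^ m` as a scalar. -/
def sgn (m : ℤ) : k := ((m.negOnePow : ℤˣ) : ℤ)

theorem sgn_add (l m : ℤ) : sgn k (l + m) = sgn k l * sgn k m := by
  simp [sgn, Int.negOnePow_add]

theorem sgn_succ (m : ℤ) : sgn k (m + 1) = -sgn k m := by
  simp [sgn, Int.negOnePow_succ]

theorem sgn_zero : sgn k 0 = 1 := by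
  simp [sgn]

theorem sgn_natCast (m : ℕ) : sgn k m = (-1) ^ m := by
  induction m with
  | zero => simp [sgn]
  | succ m ih => rw [Nat.cast_succ, sgn_succ, ih, pow_succ, mul_neg_one]

theorem sgn_eq_of_even {l m : ℤ} (h : Even (l - m)) : sgn k l = sgn k m := by
  rw [sgn, sgn, (Int.negOnePow_eq_iff l m).2 h]

theorem sgn_mul_self (m : ℤ) : sgn k m * sgn k m = 1 := by
  rw [← sgn_add, ← sgn_zero]
  exact sgn_eq_of_even (by simp)

variable (k) in
/-- The signs that turn the anticommutative meshes into commutative ones. -/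
def arrowSign {a b : RepQuiver (LinA n)} : (a ⟶ b) → k
  | .arr _ _ => sgn k a.lvl
  | .star _ _ => 1

@[simp]
theorem arrowSign_down {a b : RepQuiver (LinA n)} (h : a.pt.val + 1 = b.pt.val)
    (h' : a.lvl = b.lvl) : arrowSign k (down h h') = sgn k a.lvl := rfl

@[simp]
theorem arrowSign_up {a b : RepQuiver (LinA n)} (h : b.pt.val + 1 = a.pt.val)
    (h' : b.lvl = a.lvl - 1) : arrowSign k (up h h') = 1 := rfl

theorem arrowSign_mul_self {a b : RepQuiver (LinA n)} (e : a ⟶ b) :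
    arrowSign k e * arrowSign k e = 1 := by
  rcases e with _ | _
  · exact sgn_mul_self _
  · exact one_mul 1

open MeshCat

theorem proj_meshBelow_add_meshAbove (b : RepQuiver (LinA n)) :
    (meshIdeal k (RepQuiver (LinA n))).proj.map (meshBelow k b) +
      (meshIdeal k (RepQuiver (LinA n))).proj.map (meshAbove k b) = 0 := by
  rw [← Functor.map_add, ← meshRelation_eq, proj_meshRelation]

/-- Arrows with given endpoints are unique, so any two composable arrows of the right shape form the
summand. The source is only required to equal `RepQuiver.tr b`, so that the lemma also covers
`serreVertex (RepQuiver.tr b)`. -/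
theorem proj_meshBelow {a b c : RepQuiver (LinA n)} (f : a ⟶ c) (g : c ⟶ b)
    (hc : c.pt.val = b.pt.val + 1) (ha : a = RepQuiver.tr b) :
    (meshIdeal k (RepQuiver (LinA n))).proj.map (meshBelow k b) =
      eqToHom (by rw [ha]) ≫ arrow k f ≫ arrow k g := by
  subst ha
  have h : b.pt.val < n := by have := c.pt.le; omega
  obtain rfl : c = predBelow b h := by
    refine vertex_ext hc ?_
    rcases arrow_cases g with ⟨h, h', -⟩ | ⟨h, h', -⟩
    · omega
    · simp only [predBelow]; omega
  rw [meshBelow, dif_pos h, Functor.map_comp, eqToHom_refl, Category.id_comp,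
    Subsingleton.elim f (toPredBelow b h), Subsingleton.elim g (ofPredBelow b h)]

theorem proj_meshAbove {a b c : RepQuiver (LinA n)} (f : a ⟶ c) (g : c ⟶ b)
    (hc : c.pt.val + 1 = b.pt.val) (ha : a = RepQuiver.tr b) :
    (meshIdeal k (RepQuiver (LinA n))).proj.map (meshAbove k b) =
      eqToHom (by rw [ha]) ≫ arrow k f ≫ arrow k g := by
  subst ha
  have h : 1 < b.pt.val := by have := c.pt.one_le; omega
  obtain rfl : c = predAbove b h := by
    refine vertex_ext (by simp only [predAbove]; omega) ?_
    rcases arrow_cases g with ⟨h, h', -⟩ | ⟨h, h', -⟩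
    · exact h'
    · omega
  rw [meshAbove, dif_pos h, Functor.map_comp, eqToHom_refl, Category.id_comp,
    Subsingleton.elim f (toPredAbove b h), Subsingleton.elim g (ofPredAbove b h)]

/-- The two paths around a square add up to zero. -/
theorem arrow_comp_add_arrow_comp {a b c d : RepQuiver (LinA n)} (f : a ⟶ c) (g : c ⟶ b)
    (f' : a ⟶ d) (g' : d ⟶ b) (hc : c.pt.val = b.pt.val + 1) (hd : d.pt.val + 1 = b.pt.val)
    (ha : a = RepQuiver.tr b) :
    arrow k f ≫ arrow k g + arrow k f' ≫ arrow k g' = 0 := by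
  subst ha
  have h := proj_meshBelow_add_meshAbove (k := k) b
  rwa [proj_meshBelow f g hc rfl, proj_meshAbove f' g' hd rfl, eqToHom_refl, Category.id_comp,
    Category.id_comp] at h

theorem arrow_comp_eq_zero_of_eq_one {a b c : RepQuiver (LinA n)} (f : a ⟶ c) (g : c ⟶ b)
    (hb : b.pt.val = 1) (hc : c.pt.val = b.pt.val + 1) (ha : a = RepQuiver.tr b) :
    arrow k f ≫ arrow k g = 0 := by
  subst ha
  have h := proj_meshBelow_add_meshAbove (k := k) b
  rwa [proj_meshBelow f g hc rfl, meshAbove, dif_neg (by omega), Functor.map_zero, add_zero,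
    eqToHom_refl, Category.id_comp] at h

theorem arrow_comp_eq_zero_of_eq {a b c : RepQuiver (LinA n)} (f : a ⟶ c) (g : c ⟶ b)
    (hb : b.pt.val = n) (hc : c.pt.val + 1 = b.pt.val) (ha : a = RepQuiver.tr b) :
    arrow k f ≫ arrow k g = 0 := by
  subst ha
  have h := proj_meshBelow_add_meshAbove (k := k) b
  rwa [proj_meshAbove f g hc rfl, meshBelow, dif_neg (by omega), Functor.map_zero, zero_add,
    eqToHom_refl, Category.id_comp] at h

variable (k) in
/-- An arrow with its sign, as a morphism of the mesh category. -/
noncomputable def signedArrow {a b : RepQuiver (LinA n)} (e : a ⟶ b) :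
    vertex k a ⟶ vertex k b :=
  arrowSign k e • arrow k e

/-- If i is the level of `b`, the route through `c` carries the sign (-1)^(i+1) and the route
through `d` carries (-1)^i. These opposite signs absorb the minus sign of the mesh relation. -/
theorem signedArrow_comm {a b c d : RepQuiver (LinA n)} (f : a ⟶ c) (g : c ⟶ b)
    (f' : a ⟶ d) (g' : d ⟶ b) (hc : c.pt.val = b.pt.val + 1) (hd : d.pt.val + 1 = b.pt.val)
    (ha : a = RepQuiver.tr b) :
    signedArrow k f ≫ signedArrow k g = signedArrow k f' ≫ signedArrow k g' := by
  have h := arrow_comp_add_arrow_comp (k := k) f g f' g' hc hd ha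
  have hav : a.pt.val = b.pt.val := by rw [ha]; rfl
  have hal : a.lvl = b.lvl + 1 := by rw [ha]; rfl
  rcases arrow_cases f with ⟨h1, h1', rfl⟩ | ⟨h1, h1', -⟩
  swap
  · omega
  rcases arrow_cases g with ⟨h2, h2', -⟩ | ⟨h2, h2', rfl⟩
  · omega
  rcases arrow_cases f' with ⟨h3, h3', -⟩ | ⟨h3, h3', rfl⟩
  · omega
  rcases arrow_cases g' with ⟨h4, h4', rfl⟩ | ⟨h4, h4', -⟩
  swap
  · omega
  have hd' : d.lvl = b.lvl := by omega
  simp only [signedArrow, arrowSign_up, arrowSign_down, one_smul, Linear.comp_smul,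
    Linear.smul_comp]
  rw [eq_neg_of_add_eq_zero_left h, hal, hd', sgn_succ]
  simp

/-! ### The grid order on vertices, and rectangles -/

/-- The number `q - 2 * i` for a vertex `(q, i)`. Every arrow increases it by one. -/
def deg (a : RepQuiver (LinA n)) : ℤ := a.pt.val - 2 * a.lvl

/-- `b` lies in the quadrant to the right of `a`. -/
def Reach (a b : RepQuiver (LinA n)) : Prop :=
  (a.pt.val : ℤ) - a.lvl ≤ b.pt.val - b.lvl ∧ b.lvl ≤ a.lvl

/-- `b` lies in the rectangle that starts in `a`. -/
def InRect (a b : RepQuiver (LinA n)) : Prop :=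
  Reach a b ∧ (b.pt.val : ℤ) - b.lvl + a.lvl ≤ n ∧ a.lvl + 1 ≤ a.pt.val + b.lvl

theorem Reach.refl (a : RepQuiver (LinA n)) : Reach a a := ⟨le_rfl, le_rfl⟩

theorem Reach.trans {a b c : RepQuiver (LinA n)} (h : Reach a b) (h' : Reach b c) : Reach a c :=
  ⟨h.1.trans h'.1, h'.2.trans h.2⟩

theorem Reach.of_arrow {a b : RepQuiver (LinA n)} (e : a ⟶ b) : Reach a b := by
  rcases arrow_cases e with ⟨h, h', -⟩ | ⟨h, h', -⟩ <;> constructor <;> omega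

theorem Reach.of_path {a b : RepQuiver (LinA n)} (p : Quiver.Path a b) : Reach a b := by
  induction p with
  | nil => exact Reach.refl a
  | cons p e ih => exact ih.trans (Reach.of_arrow e)

theorem Reach.deg_le {a b : RepQuiver (LinA n)} (h : Reach a b) : deg a ≤ deg b := by
  obtain ⟨h1, h2⟩ := h
  simp only [deg]
  omega

theorem Reach.antisymm {a b : RepQuiver (LinA n)} (h : Reach a b) (h' : deg b ≤ deg a) :
    a = b := by
  obtain ⟨h1, h2⟩ := h
  simp only [deg] at h'
  exact vertex_ext (by omega) (by omega)

theorem deg_of_arrow {a b : RepQuiver (LinA n)} (e : a ⟶ b) : deg b = deg a + 1 := by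
  simp only [deg]
  rcases arrow_cases e with ⟨h, h', -⟩ | ⟨h, h', -⟩ <;> omega

theorem InRect.refl (a : RepQuiver (LinA n)) : InRect a a := by
  have := a.pt.le
  have := a.pt.one_le
  exact ⟨Reach.refl a, by omega, by omega⟩

/-- Together with `InRect.right`: the upper bounds on x and y are inherited by earlier endpoints,
and they only grow when the starting corner moves forward. -/
theorem InRect.left {a b c : RepQuiver (LinA n)} (h : InRect a c) (hab : Reach a b)
    (hbc : Reach b c) : InRect a b := by
  obtain ⟨-, h1, h2⟩ := h
  obtain ⟨h3, h4⟩ := hbc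
  exact ⟨hab, by omega, by omega⟩

theorem InRect.right {a b c : RepQuiver (LinA n)} (h : InRect a c) (hab : Reach a b)
    (hbc : Reach b c) : InRect b c := by
  obtain ⟨-, h1, h2⟩ := h
  obtain ⟨h3, h4⟩ := hab
  exact ⟨hbc, by omega, by omega⟩

/-- The degree is x + y, and the sides of the rectangle have lengths n - p and p - 1, so its
diagonal corners differ in degree by n - 1. -/
theorem InRect.deg_lt {a b : RepQuiver (LinA n)} (h : InRect a b) : deg b < deg a + n := by
  obtain ⟨-, h1, h2⟩ := h
  simp only [deg]
  omega

theorem InRect.exists_path {a b : RepQuiver (LinA n)} (h : InRect a b) :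
    Nonempty (Quiver.Path a b) := by
  generalize hN : (deg b - deg a).toNat = N
  induction N generalizing b with
  | zero =>
    obtain rfl : a = b := h.1.antisymm (by omega)
    exact ⟨Quiver.Path.nil⟩
  | succ N ih =>
    have ha := a.pt.one_le
    have hb := b.pt.le
    obtain ⟨⟨h1, h2⟩, h3, h4⟩ := h
    suffices H : ∃ c, InRect a c ∧ Nonempty (c ⟶ b) by
      obtain ⟨c, hc, ⟨e⟩⟩ := H
      obtain ⟨p⟩ := ih hc (by have := deg_of_arrow e; omega)
      exact ⟨p.cons e⟩
    -- The path is built backwards from `b`: undo `up` steps until the level of `a` is reached, then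
    -- `down` steps. The bounds of the rectangle keep this walk inside the strip.
    by_cases hl : b.lvl < a.lvl
    · have hb' : b.pt.val < n := by omega
      refine ⟨predBelow b hb', ?_, ⟨ofPredBelow b hb'⟩⟩
      refine ⟨⟨?_, ?_⟩, ?_, ?_⟩ <;> simp only [predBelow] <;> omega
    · have hb' : 1 < b.pt.val := by
        simp only [deg] at hN
        omega
      refine ⟨predAbove b hb', ?_, ⟨ofPredAbove b hb'⟩⟩
      simp only [deg] at hN
      refine ⟨⟨?_, ?_⟩, ?_, ?_⟩ <;> simp only [predAbove] <;> omega

variable (k) in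
/-- The product of the signs of the arrows of a path. -/
def pathSign {a b : RepQuiver (LinA n)} (p : Quiver.Path a b) : k :=
  p.weight (arrowSign k)

theorem pathSign_nil (a : RepQuiver (LinA n)) :
    pathSign k (Quiver.Path.nil : Quiver.Path a a) = 1 :=
  Quiver.Path.weight_nil _ a

theorem pathSign_cons {a b c : RepQuiver (LinA n)} (p : Quiver.Path a b) (e : b ⟶ c) :
    pathSign k (p.cons e) = pathSign k p * arrowSign k e :=
  Quiver.Path.weight_cons _ p e

theorem pathSign_comp {a b c : RepQuiver (LinA n)} (p : Quiver.Path a b) (q : Quiver.Path b c) :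
    pathSign k (p.comp q) = pathSign k p * pathSign k q :=
  Quiver.Path.weight_comp _ p q

theorem pathSign_mul_self {a b : RepQuiver (LinA n)} (p : Quiver.Path a b) :
    pathSign k p * pathSign k p = 1 := by
  induction p with
  | nil => rw [pathSign_nil, one_mul]
  | cons p e ih => rw [pathSign_cons, mul_mul_mul_comm, ih, arrowSign_mul_self, one_mul]

variable (k) in
/-- A path with its sign, as a morphism of the mesh category. -/
noncomputable def signedPath {a b : RepQuiver (LinA n)} (p : Quiver.Path a b) :
    vertex k a ⟶ vertex k b :=
  pathSign k p • pathHom k p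

theorem signedPath_cons {a b c : RepQuiver (LinA n)} (p : Quiver.Path a b) (e : b ⟶ c) :
    signedPath k (p.cons e) = signedPath k p ≫ signedArrow k e := by
  rw [signedPath, pathSign_cons, pathHom_cons, signedPath, signedArrow, Linear.comp_smul,
    Linear.smul_comp, smul_smul, mul_comm]

theorem pathSign_smul_signedPath {a b : RepQuiver (LinA n)} (p : Quiver.Path a b) :
    pathSign k p • signedPath k p = pathHom k p := by
  rw [signedPath, smul_smul, pathSign_mul_self, one_smul]

/-! ### Parallel paths agree up to sign -/

section Parallel

variable (k) in
/-- All signed paths from `a` to `b` coincide, and they vanish if `b` is not in the rectangle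
that starts in `a`. -/
def Coherent (a b : RepQuiver (LinA n)) : Prop :=
  (∀ p p' : Quiver.Path a b, signedPath k p = signedPath k p') ∧
    (¬InRect a b → ∀ p : Quiver.Path a b, signedPath k p = 0)

theorem signedArrow_comp_eq_zero {a b c : RepQuiver (LinA n)} {f : a ⟶ c} {g : c ⟶ b}
    (h : arrow k f ≫ arrow k g = 0) : signedArrow k f ≫ signedArrow k g = 0 := by
  rw [signedArrow, signedArrow, Linear.comp_smul, Linear.smul_comp, h, smul_zero, smul_zero]

/-- If `c` is still in the rectangle, the last arrow crosses a far side. The path may be rerouted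
through τ(b), so that it ends in half of a mesh. At the border of the strip this half is zero;
otherwise the other half passes through a vertex already outside the rectangle. -/
theorem signedPath_cons_eq_zero {a b c : RepQuiver (LinA n)} (p : Quiver.Path a c) (e : c ⟶ b)
    (hb : ¬InRect a b) (h : ∀ d, (d ⟶ b) → Coherent k a d) : signedPath k (p.cons e) = 0 := by
  rw [signedPath_cons]
  by_cases hc : InRect a c
  swap
  · rw [(h c e).2 hc, Limits.zero_comp]
  have ha1 := a.pt.one_le
  have ha2 := a.pt.le
  have hb1 := b.pt.one_le
  have hb2 := b.pt.le
  have hreach : Reach a b := hc.1.trans (Reach.of_arrow e)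
  obtain ⟨⟨h1, h2⟩, h3, h4⟩ := id hc
  have hb' : ¬((b.pt.val : ℤ) - b.lvl + a.lvl ≤ n ∧ a.lvl + 1 ≤ a.pt.val + b.lvl) :=
    fun h => hb ⟨hreach, h⟩
  -- The vertex τ(b) is one step before `c` along the side being crossed. It does not fall behind
  -- `a`, because `b` itself lies in the strip.
  have ht : InRect a (RepQuiver.tr b) := by
    rcases arrow_cases e with ⟨h5, h5', -⟩ | ⟨h5, h5', -⟩ <;>
      refine ⟨⟨?_, ?_⟩, ?_, ?_⟩ <;> simp only [RepQuiver.tr, Equiv.coe_fn_mk] <;> omega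
  obtain ⟨r⟩ := ht.exists_path
  rcases arrow_cases e with ⟨h5, h5', -⟩ | ⟨h5, h5', -⟩
  · let f : RepQuiver.tr b ⟶ c := up h5 (by simp [RepQuiver.tr, h5'])
    rw [(h c e).1 p (r.cons f), signedPath_cons, Category.assoc]
    by_cases hn : b.pt.val = n
    · rw [signedArrow_comp_eq_zero (arrow_comp_eq_zero_of_eq f e hn h5 rfl), Limits.comp_zero]
    · have hlt : b.pt.val < n := by omega
      rw [← signedArrow_comm (toPredBelow b hlt) (ofPredBelow b hlt) f e rfl h5 rfl,
        ← Category.assoc, ← signedPath_cons, (h _ (ofPredBelow b hlt)).2, Limits.zero_comp]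
      rintro ⟨-, h6, h7⟩
      simp only [predBelow] at h6 h7
      omega
  · let f : RepQuiver.tr b ⟶ c := down h5 (by simp only [RepQuiver.tr, Equiv.coe_fn_mk]; omega)
    rw [(h c e).1 p (r.cons f), signedPath_cons, Category.assoc]
    by_cases hn : b.pt.val = 1
    · rw [signedArrow_comp_eq_zero (arrow_comp_eq_zero_of_eq_one f e hn h5.symm rfl),
        Limits.comp_zero]
    · have hlt : 1 < b.pt.val := by omega
      rw [signedArrow_comm f e (toPredAbove b hlt) (ofPredAbove b hlt) h5.symm
        (predAbove_pt b hlt) rfl, ← Category.assoc, ← signedPath_cons,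
        (h _ (ofPredAbove b hlt)).2, Limits.zero_comp]
      rintro ⟨-, h6, h7⟩
      simp only [predAbove] at h6 h7
      omega

/-- A vertex `b` reached from both sides has τ(b) in the rectangle as well. Coherence at `c` and at
`d` lets both paths start with the same path to τ(b), and the last square commutes. -/
theorem signedPath_cons_eq_signedPath_cons {a b c d : RepQuiver (LinA n)} (p : Quiver.Path a c)
    (e : c ⟶ b) (p' : Quiver.Path a d) (e' : d ⟶ b) (hc : c.pt.val = b.pt.val + 1)
    (hd : d.pt.val + 1 = b.pt.val) (hb : InRect a b) (h : ∀ d, (d ⟶ b) → Coherent k a d) :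
    signedPath k (p.cons e) = signedPath k (p'.cons e') := by
  have hc' : c.lvl = b.lvl + 1 := by
    rcases arrow_cases e with ⟨h5, h5', -⟩ | ⟨h5, h5', -⟩ <;> omega
  have hd' : d.lvl = b.lvl := by
    rcases arrow_cases e' with ⟨h5, h5', -⟩ | ⟨h5, h5', -⟩ <;> omega
  let f : RepQuiver.tr b ⟶ c := down hc.symm hc'.symm
  let f' : RepQuiver.tr b ⟶ d := up hd (by simp [RepQuiver.tr, hd'])
  have ht : Reach a (RepQuiver.tr b) := by
    obtain ⟨h1, h2⟩ := Reach.of_path p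
    obtain ⟨h3, h4⟩ := Reach.of_path p'
    constructor <;> simp only [RepQuiver.tr, Equiv.coe_fn_mk] <;> omega
  obtain ⟨r⟩ := (hb.left ht ((Reach.of_arrow f).trans (Reach.of_arrow e))).exists_path
  rw [signedPath_cons, signedPath_cons, (h c e).1 p (r.cons f), (h d e').1 p' (r.cons f'),
    signedPath_cons, signedPath_cons, Category.assoc, Category.assoc,
    signedArrow_comm f e f' e' hc hd rfl]

variable (k) in
theorem coherent (a b : RepQuiver (LinA n)) : Coherent k a b := by
  generalize hN : (deg b - deg a).toNat = N
  induction N using Nat.strong_induction_on generalizing b with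
  | _ N ih =>
  by_cases hab : Reach a b
  swap
  · exact ⟨fun p => (hab (Reach.of_path p)).elim, fun _ p => (hab (Reach.of_path p)).elim⟩
  have h : ∀ d, (d ⟶ b) → Coherent k a d := by
    intro d e
    by_cases had : Reach a d
    · refine ih _ ?_ d rfl
      have := deg_of_arrow e
      have := had.deg_le
      omega
    · exact ⟨fun p => (had (Reach.of_path p)).elim, fun _ p => (had (Reach.of_path p)).elim⟩
  have hzero : ¬InRect a b → ∀ p : Quiver.Path a b, signedPath k p = 0 := by
    intro hb p
    cases p with
    | nil => exact (hb (InRect.refl a)).elim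
    | cons p e => exact signedPath_cons_eq_zero p e hb h
  refine ⟨fun p p' => ?_, hzero⟩
  by_cases hb : InRect a b
  swap
  · rw [hzero hb, hzero hb]
  -- Arrows raise the degree, so the empty path is never parallel to a nonempty one.
  have hloop : ∀ {c : RepQuiver (LinA n)}, Quiver.Path b c → (c ⟶ b) → False := fun q e => by
    have h1 := (Reach.of_path q).deg_le
    have h2 := deg_of_arrow e
    omega
  cases p with
  | nil =>
    cases p' with
    | nil => rfl
    | cons p' e' => exact (hloop p' e').elim
  | @cons c _ p e =>
    cases p' with
    | nil => exact (hloop p e).elim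
    | @cons d _ p' e' =>
      by_cases hcd : c = d
      · subst hcd
        rw [Subsingleton.elim e e', signedPath_cons, signedPath_cons, (h c e).1 p p']
      rcases arrow_cases e with ⟨h1, h1', -⟩ | ⟨h1, h1', -⟩ <;>
        rcases arrow_cases e' with ⟨h2, h2', -⟩ | ⟨h2, h2', -⟩
      · exact (hcd (vertex_ext (by omega) (by omega))).elim
      · exact (signedPath_cons_eq_signedPath_cons p' e' p e h2.symm h1 hb h).symm
      · exact signedPath_cons_eq_signedPath_cons p e p' e' h1.symm h2 hb h
      · exact (hcd (vertex_ext (by omega) (by omega))).elim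

end Parallel

/-! ### Coefficients: the hom-modules in a rectangle are nonzero -/

section Coeff

/-- The linear extension of `pathSign` to the path category. -/
noncomputable def signSum (a b : RepQuiver (LinA n)) :
    (PathCat.vertex k a ⟶ PathCat.vertex k b) →ₗ[k] k :=
  PathCat.linearExtension (pathSign k)

theorem signSum_pathHom {a b : RepQuiver (LinA n)} (p : Quiver.Path a b) :
    signSum a b (PathCat.pathHom k p) = pathSign k p :=
  PathCat.linearExtension_pathHom _ p

theorem signSum_arrow {a b : RepQuiver (LinA n)} (e : a ⟶ b) :
    signSum a b (PathCat.arrow k e) = arrowSign k e :=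
  (signSum_pathHom (Quiver.Path.nil.cons e)).trans (by rw [pathSign_cons, pathSign_nil, one_mul])

theorem signSum_comp {a b c : RepQuiver (LinA n)} (f : PathCat.vertex k a ⟶ PathCat.vertex k b)
    (g : PathCat.vertex k b ⟶ PathCat.vertex k c) :
    signSum a c (f ≫ g) = signSum a b f * signSum b c g := by
  refine PathCat.comp_eq_of_path _ (((LinearMap.mul k k).compl₂ (signSum b c)).comp (signSum a b))
    (fun p q => ?_) f g
  rw [← PathCat.pathHom_comp, signSum_pathHom, pathSign_comp, ← signSum_pathHom, ← signSum_pathHom]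
  rfl

/-- Away from the border the two summands have opposite signs. On the border the lone summand has
sign ±1, hence the strict bounds. -/
theorem signSum_meshRelation (b : RepQuiver (LinA n)) (h1 : 1 < b.pt.val) (h2 : b.pt.val < n) :
    signSum (StableTranslationQuiver.tr b) b (meshRelation k b) = 0 := by
  change signSum (RepQuiver.tr b) b _ = 0
  rw [meshRelation_eq, map_add, meshBelow, meshAbove, dif_pos h1, dif_pos h2, signSum_comp,
    signSum_comp, signSum_arrow, signSum_arrow, signSum_arrow, signSum_arrow, toPredBelow,
    ofPredBelow, toPredAbove, ofPredAbove, arrowSign_up, arrowSign_up, arrowSign_down,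
    arrowSign_down, tr_lvl, predAbove_lvl, sgn_succ, mul_one, one_mul, neg_add_cancel]

theorem pathCat_eq_zero {a b : RepQuiver (LinA n)} (h : ¬Reach a b)
    (f : PathCat.vertex k a ⟶ PathCat.vertex k b) : f = 0 := by
  induction f using PathCat.hom_induction with
  | zero => rfl
  | add f g hf hg => rw [hf, hg, add_zero]
  | smul c f hf => rw [hf, smul_zero]
  | path p => exact (h (Reach.of_path p)).elim

theorem signSum_eq_zero_of_mem {a b : RepQuiver (LinA n)} (hab : InRect a b)
    (f : PathCat.vertex k a ⟶ PathCat.vertex k b)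
    (hf : f ∈ (meshIdeal k (RepQuiver (LinA n))).hom _ _) : signSum a b f = 0 := by
  refine CatIdeal.generate_induction (P := fun f => signSum a b f = 0) (map_zero _) ?_ ?_ ?_ hf
  · intro f g hf hg
    rw [map_add, hf, hg, add_zero]
  · intro c f hf
    rw [map_smul, hf, smul_zero]
  · rintro X Y f s g ⟨c⟩
    by_cases h1 : Reach a (RepQuiver.tr c)
    swap
    · rw [pathCat_eq_zero h1 f, Limits.zero_comp, map_zero]
    by_cases h2 : Reach c b
    swap
    · rw [pathCat_eq_zero h2 g, Limits.comp_zero, Limits.comp_zero, map_zero]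
    obtain ⟨-, h3, h4⟩ := hab
    obtain ⟨h5, h6⟩ := h1
    obtain ⟨h7, h8⟩ := h2
    simp only [RepQuiver.tr, Equiv.coe_fn_mk] at h5 h6
    -- Since τ(c) is reachable from `a` and `b` from `c`, the bounds of the rectangle keep `c` off
    -- both borders of the strip.
    rw [signSum_comp, signSum_comp, signSum_meshRelation c (by omega) (by omega), zero_mul,
      mul_zero]

open Classical in
/-- The coefficient of a morphism of the mesh category with respect to the signed paths. -/
noncomputable def coeff (a b : RepQuiver (LinA n)) : (vertex k a ⟶ vertex k b) →ₗ[k] k :=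
  if h : InRect a b then
    (meshIdeal k (RepQuiver (LinA n))).descend (signSum a b) (signSum_eq_zero_of_mem h)
  else 0

theorem coeff_proj {a b : RepQuiver (LinA n)} (h : InRect a b)
    (f : PathCat.vertex k a ⟶ PathCat.vertex k b) :
    coeff a b ((meshIdeal k (RepQuiver (LinA n))).proj.map f) = signSum a b f := by
  rw [coeff, dif_pos h, CatIdeal.descend_proj_map]

theorem coeff_pathHom {a b : RepQuiver (LinA n)} (h : InRect a b) (p : Quiver.Path a b) :
    coeff a b (pathHom k p) = pathSign k p := by
  rw [pathHom, coeff_proj h, signSum_pathHom]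

theorem coeff_arrow {a b : RepQuiver (LinA n)} (h : InRect a b) (e : a ⟶ b) :
    coeff a b (arrow k e) = arrowSign k e := by
  rw [arrow, coeff_proj h, signSum_arrow]

theorem coeff_id (a : RepQuiver (LinA n)) : coeff a a (𝟙 (vertex k a)) = 1 := by
  rw [← pathHom_nil, coeff_pathHom (InRect.refl a), pathSign_nil]

theorem coeff_comp {a b c : RepQuiver (LinA n)} (hac : InRect a c) (hab : InRect a b)
    (hbc : InRect b c) (f : vertex k a ⟶ vertex k b) (g : vertex k b ⟶ vertex k c) :
    coeff a c (f ≫ g) = coeff a b f * coeff b c g := by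
  obtain ⟨f, rfl⟩ := (meshIdeal k (RepQuiver (LinA n))).proj.map_surjective f
  obtain ⟨g, rfl⟩ := (meshIdeal k (RepQuiver (LinA n))).proj.map_surjective g
  rw [← Functor.map_comp, coeff_proj hac, coeff_proj hab, coeff_proj hbc, signSum_comp]

theorem eq_zero_of_not_inRect {a b : RepQuiver (LinA n)} (h : ¬InRect a b)
    (f : vertex k a ⟶ vertex k b) : f = 0 := by
  induction f using MeshCat.hom_induction with
  | zero => rfl
  | add f g hf hg => rw [hf, hg, add_zero]
  | smul c f hf => rw [hf, smul_zero]
  | path p => rw [← pathSign_smul_signedPath, (coherent k a b).2 h, smul_zero]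

theorem eq_coeff_smul {a b : RepQuiver (LinA n)} (h : InRect a b) (p : Quiver.Path a b)
    (f : vertex k a ⟶ vertex k b) : f = coeff a b f • signedPath k p := by
  induction f using MeshCat.hom_induction with
  | zero => rw [map_zero, zero_smul]
  | add f g hf hg => rw [map_add, add_smul, ← hf, ← hg]
  | smul c f hf => rw [map_smul, smul_assoc, ← hf]
  | path q =>
    rw [coeff_pathHom h, (coherent k a b).1 p q, pathSign_smul_signedPath]

theorem eq_zero_of_coeff_eq_zero {a b : RepQuiver (LinA n)} (f : vertex k a ⟶ vertex k b)
    (hf : coeff a b f = 0) : f = 0 := by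
  by_cases h : InRect a b
  · obtain ⟨p⟩ := h.exists_path
    rw [eq_coeff_smul h p f, hf, zero_smul]
  · exact eq_zero_of_not_inRect h f

theorem exists_coeff_eq {a b : RepQuiver (LinA n)} (h : InRect a b) (x : k) :
    ∃ f : vertex k a ⟶ vertex k b, coeff a b f = x := by
  obtain ⟨p⟩ := h.exists_path
  refine ⟨x • signedPath k p, ?_⟩
  rw [map_smul, signedPath, map_smul, coeff_pathHom h, smul_eq_mul, smul_eq_mul,
    pathSign_mul_self, mul_one]

/-- The hom-module between two vertices is isomorphic to `k` if the second one lies in the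
rectangle that starts in the first one. -/
noncomputable def coeffEquiv {a b : RepQuiver (LinA n)} (h : InRect a b) :
    (vertex k a ⟶ vertex k b) ≃ₗ[k] k :=
  LinearEquiv.ofBijective (coeff a b)
    ⟨(injective_iff_map_eq_zero _).2 eq_zero_of_coeff_eq_zero, exists_coeff_eq h⟩

end Coeff

/-! ### Finiteness, endomorphisms and ranks -/

section HomModules

variable (k n) in
theorem homFinite : HomFinite k (MeshRepA k n) := by
  suffices H : ∀ a b : RepQuiver (LinA n), Module.Finite k (vertex k a ⟶ vertex k b) ∧
      Module.Projective k (vertex k a ⟶ vertex k b) from fun X Y => H X.as Y.as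
  intro a b
  by_cases h : InRect a b
  · exact ⟨Module.Finite.equiv (coeffEquiv h).symm,
      Module.Projective.of_equiv (coeffEquiv h).symm⟩
  · have : Subsingleton (vertex k a ⟶ vertex k b) :=
      subsingleton_of_forall_eq 0 (eq_zero_of_not_inRect h)
    exact ⟨inferInstance, inferInstance⟩

theorem finite_of_lvl_bounds (s : Set (RepQuiver (LinA n))) (l m : ℤ)
    (hs : ∀ a ∈ s, l ≤ a.lvl ∧ a.lvl ≤ m) : s.Finite := by
  refine Set.Finite.of_injOn (f := fun a => ((a.pt.val : ℤ), a.lvl))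
    (t := (Set.Icc (0 : ℤ) n) ×ˢ Set.Icc l m) ?_ ?_
    ((Set.finite_Icc _ _).prod (Set.finite_Icc _ _))
  · intro a ha
    exact ⟨⟨by simp, by simpa using a.pt.le⟩, hs a ha⟩
  · intro a _ b _ h
    simp only [Prod.mk.injEq, Nat.cast_inj] at h
    exact vertex_ext h.1 h.2

variable (k n) in
theorem locallyBounded : LocallyBounded (MeshRepA k n) := by
  have hinj : Function.Injective (fun X : MeshRepA k n => (show RepQuiver (LinA n) from X.as)) :=
    fun X Y h => Quotient.ext h
  have key : ∀ (a b : RepQuiver (LinA n)) (f : vertex k a ⟶ vertex k b), f ≠ 0 → InRect a b :=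
    fun a b f hf => by_contra fun h => hf (eq_zero_of_not_inRect h f)
  intro X
  let a : RepQuiver (LinA n) := X.as
  constructor
  · refine Set.Finite.subset ((finite_of_lvl_bounds {b | InRect b a} a.lvl (a.lvl + n) ?_).preimage
      hinj.injOn) ?_
    · rintro b ⟨⟨h1, h2⟩, h3, h4⟩
      have := a.pt.one_le
      exact ⟨by omega, by omega⟩
    · rintro Y ⟨f, hf⟩
      exact key Y.as a f hf
  · refine Set.Finite.subset ((finite_of_lvl_bounds {b | InRect a b} (a.lvl - n) a.lvl ?_).preimage
      hinj.injOn) ?_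
    · rintro b ⟨⟨h1, h2⟩, h3, h4⟩
      have := a.pt.le
      exact ⟨by omega, by omega⟩
    · rintro Y ⟨f, hf⟩
      exact key a Y.as f hf

-- The complement of 𝕜 · id is zero because the rectangle of a vertex meets its own vertex only in
-- the constant path. Nonzero morphisms both ways between two vertices would force them to be equal.
variable (k n) in
theorem isStrongRetractionFamily_bot :
    IsStrongRetractionFamily k (fun X : MeshRepA k n => (⊥ : Submodule k (X ⟶ X))) where
  exists_retraction := by
    suffices H : ∀ a : RepQuiver (LinA n), ∃ t : (vertex k a ⟶ vertex k a) →ₗ[k] k,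
        ∀ x : k, t (x • 𝟙 (vertex k a)) = x from fun X => H X.as
    exact fun a => ⟨coeff a a, fun x => by rw [map_smul, coeff_id, smul_eq_mul, mul_one]⟩
  isCompl := by
    suffices H : ∀ a : RepQuiver (LinA n),
        IsCompl (Submodule.span k {𝟙 (vertex k a)}) ⊥ from fun X => H X.as
    intro a
    refine ⟨disjoint_bot_right, codisjoint_bot.2 (eq_top_iff.2 fun f _ => ?_)⟩
    rw [Submodule.mem_span_singleton]
    refine ⟨coeff a a f, ?_⟩
    rw [eq_coeff_smul (InRect.refl a) Quiver.Path.nil f, map_smul]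
    have : signedPath k (Quiver.Path.nil : Quiver.Path a a) = 𝟙 _ := by
      rw [signedPath, pathHom_nil, pathSign_nil, one_smul]
    rw [this, coeff_id, smul_eq_mul, mul_one]
  comp_mem := by
    rintro X f g hf hg
    rw [Submodule.mem_bot] at hf ⊢
    rw [hf, Limits.zero_comp]
  comp_mem_of_ne := by
    suffices H : ∀ a b : RepQuiver (LinA n), a ≠ b → ∀ (f : vertex k a ⟶ vertex k b)
        (g : vertex k b ⟶ vertex k a), f ≫ g = 0 from
      fun X Y h f g => (Submodule.mem_bot k).2 (H X.as Y.as (fun h' => h (Quotient.ext h')) f g)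
    intro a b hab f g
    by_cases h : InRect a b
    · rw [eq_zero_of_not_inRect (fun h' => hab (h.1.antisymm h'.1.deg_le)) g, Limits.comp_zero]
    · rw [eq_zero_of_not_inRect h f, Limits.zero_comp]

variable (k) in
theorem subsingleton_or_free [Nontrivial k] (a b : RepQuiver (LinA n)) :
    (Subsingleton (vertex k a ⟶ vertex k b) ∨ (Module.Free k (vertex k a ⟶ vertex k b) ∧
      Module.finrank k (vertex k a ⟶ vertex k b) = 1)) ∧
    ((Module.Free k (vertex k a ⟶ vertex k b) ∧
      Module.finrank k (vertex k a ⟶ vertex k b) = 1) ↔ InRect a b) := by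
  by_cases h : InRect a b
  · have : Module.Free k (vertex k a ⟶ vertex k b) ∧
        Module.finrank k (vertex k a ⟶ vertex k b) = 1 :=
      ⟨Module.Free.of_equiv (coeffEquiv h).symm, by
        rw [(coeffEquiv h).finrank_eq, Module.finrank_self]⟩
    exact ⟨Or.inr this, iff_of_true this h⟩
  · have hs : Subsingleton (vertex k a ⟶ vertex k b) :=
      subsingleton_of_forall_eq 0 (eq_zero_of_not_inRect h)
    refine ⟨Or.inl hs, iff_of_false ?_ h⟩
    rintro ⟨-, h1⟩
    rw [Module.finrank_zero_of_subsingleton] at h1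
    exact zero_ne_one h1

end HomModules

/-! ### The arrow ideal and its powers -/

section ArrowIdeal

theorem arrowIdeal_self (a : RepQuiver (LinA n)) :
    (arrowIdeal k (RepQuiver (LinA n))).hom (vertex k a) (vertex k a) = ⊥ := by
  rw [eq_bot_iff]
  intro f hf
  refine CatIdeal.generate_induction (P := fun f => f ∈ (⊥ : Submodule k _))
    (Submodule.zero_mem _) (fun _ _ => Submodule.add_mem _) (fun c _ => Submodule.smul_mem _ c)
    ?_ hf
  rintro X Y f s g ⟨e⟩
  rename_i b c
  rw [Submodule.mem_bot]
  -- A nonzero composite would return to `a` although the arrow `e` raises the degree and the outer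
  -- factors do not lower it.
  by_cases h1 : InRect a b
  · by_cases h2 : InRect c a
    · have := h1.1.deg_le
      have := h2.1.deg_le
      have := deg_of_arrow e
      omega
    · rw [eq_zero_of_not_inRect h2 g, Limits.comp_zero, Limits.comp_zero]
  · rw [eq_zero_of_not_inRect h1 f, Limits.zero_comp]

theorem arrowIdeal_of_ne {a b : RepQuiver (LinA n)} (hab : a ≠ b) :
    (arrowIdeal k (RepQuiver (LinA n))).hom (vertex k a) (vertex k b) = ⊤ := by
  rw [eq_top_iff]
  intro f _
  induction f using MeshCat.hom_induction with
  | zero => exact Submodule.zero_mem _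
  | add f g hf hg => exact Submodule.add_mem _ (hf trivial) (hg trivial)
  | smul c f hf => exact Submodule.smul_mem _ c (hf trivial)
  | path p =>
    cases p with
    | nil => exact (hab rfl).elim
    | cons p e =>
      rw [pathHom_cons]
      exact (arrowIdeal k _).comp_left _ (CatIdeal.mem_generate (IsArrow.mk e))

variable (k n) in
theorem isPseudoRadical_arrowIdeal : IsPseudoRadical (arrowIdeal k (RepQuiver (LinA n))) := by
  constructor
  · convert isStrongRetractionFamily_bot k n using 2 with X
    exact arrowIdeal_self X.as
  · intro X Y h
    exact arrowIdeal_of_ne (a := X.as) (b := Y.as) (fun h' => h (Quotient.ext h'))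

/-- The arrow ideal vanishes on endomorphisms, so each nonzero factor from it raises the degree by
at least one. -/
theorem arrowIdeal_pow_eq_bot {l : ℕ} {a b : RepQuiver (LinA n)} (h : deg b < deg a + l) :
    ((arrowIdeal k (RepQuiver (LinA n))).pow l).hom (vertex k a) (vertex k b) = ⊥ := by
  rw [eq_bot_iff]
  induction l generalizing a b with
  | zero =>
    intro f _
    rw [Submodule.mem_bot]
    refine eq_zero_of_not_inRect (fun h' => ?_) f
    have := h'.1.deg_le
    omega
  | succ l ih =>
    intro f hf
    refine CatIdeal.generate_induction (P := fun f => f ∈ (⊥ : Submodule k _))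
      (Submodule.zero_mem _) (fun _ _ => Submodule.add_mem _) (fun c _ => Submodule.smul_mem _ c)
      ?_ hf
    suffices H : ∀ (c d e : RepQuiver (LinA n)) (f : vertex k a ⟶ vertex k c)
        (s : vertex k c ⟶ vertex k d) (t : vertex k d ⟶ vertex k e)
        (g : vertex k e ⟶ vertex k b),
        s ∈ ((arrowIdeal k (RepQuiver (LinA n))).pow l).hom (vertex k c) (vertex k d) →
        t ∈ (arrowIdeal k (RepQuiver (LinA n))).hom (vertex k d) (vertex k e) →
        f ≫ (s ≫ t) ≫ g = 0 by
      rintro X Y f _ g ⟨Z, s, t, hs, ht, rfl⟩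
      exact (Submodule.mem_bot k).2 (H X.as Z.as Y.as f s t g hs ht)
    intro c d e f s t g hs ht
    by_cases h1 : InRect a c
    swap
    · rw [eq_zero_of_not_inRect h1 f, Limits.zero_comp]
    by_cases h2 : InRect e b
    swap
    · rw [eq_zero_of_not_inRect h2 g, Limits.comp_zero, Limits.comp_zero]
    by_cases h3 : InRect d e
    swap
    · rw [eq_zero_of_not_inRect h3 t, Limits.comp_zero, Limits.zero_comp, Limits.comp_zero]
    by_cases h4 : d = e
    · subst h4
      rw [arrowIdeal_self, Submodule.mem_bot] at ht
      rw [ht, Limits.comp_zero, Limits.zero_comp, Limits.comp_zero]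
    have h5 : deg d < deg e := lt_of_not_ge fun h' => h4 (h3.1.antisymm h')
    have h6 := h1.1.deg_le
    have h7 := h2.1.deg_le
    have hs' := ih (a := c) (b := d) (by push_cast at h; omega) hs
    rw [Submodule.mem_bot] at hs'
    rw [hs', Limits.zero_comp, Limits.zero_comp, Limits.comp_zero]

variable (k n) in
theorem arrowIdeal_pow_isZero : ((arrowIdeal k (RepQuiver (LinA n))).pow n).IsZero := by
  suffices H : ∀ a b : RepQuiver (LinA n),
      ((arrowIdeal k (RepQuiver (LinA n))).pow n).hom (vertex k a) (vertex k b) = ⊥ from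
    fun X Y => H X.as Y.as
  intro a b
  by_cases h : InRect a b
  · exact arrowIdeal_pow_eq_bot h.deg_lt
  · rw [eq_bot_iff]
    exact fun f _ => (Submodule.mem_bot k).2 (eq_zero_of_not_inRect h f)

end ArrowIdeal

/-! ### The rectangle in the plane -/

section Rectangle

theorem drawnAt_mem_rectangle_iff (a b : RepQuiver (LinA n)) :
    drawnAt b.pt.val b.lvl ∈ rectangle n a.pt.val a.lvl ↔ InRect a b := by
  obtain ⟨⟨p, hp1, hp2⟩, i⟩ := a
  obtain ⟨⟨q, hq1, hq2⟩, j⟩ := b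
  simp only [InRect, Reach]
  constructor
  · intro h
    -- At a drawn vertex, z.1 - z.2 = 2x and z.1 + z.2 = 2y. The four half-planes are therefore the
    -- four inequalities of `InRect`, doubled.
    have hconv : Convex ℝ {z : ℝ × ℝ | 2 * ((p : ℝ) - i) ≤ z.1 - z.2 ∧ z.1 - z.2 ≤ 2 * (n - i) ∧
        -2 * (i : ℝ) ≤ z.1 + z.2 ∧ z.1 + z.2 ≤ 2 * (p - i - 1)} := by
      rintro ⟨x, y⟩ ⟨h1, h2, h3, h4⟩ ⟨x', y'⟩ ⟨h1', h2', h3', h4'⟩ s t hs ht hst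
      obtain rfl : s = 1 - t := by linarith
      simp only [Prod.smul_mk, Prod.mk_add_mk, smul_eq_mul, Set.mem_ofPred_eq] at *
      refine ⟨?_, ?_, ?_, ?_⟩ <;> nlinarith
    have hp1' : (1 : ℝ) ≤ p := by exact_mod_cast hp1
    have hp2' : (p : ℝ) ≤ n := by exact_mod_cast hp2
    have hz := convexHull_min (t := {z : ℝ × ℝ | 2 * ((p : ℝ) - i) ≤ z.1 - z.2 ∧
      z.1 - z.2 ≤ 2 * (n - i) ∧ -2 * (i : ℝ) ≤ z.1 + z.2 ∧ z.1 + z.2 ≤ 2 * (p - i - 1)})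
      (by
        rintro z (rfl | rfl | rfl | rfl) <;>
          simp only [drawnAt, Set.mem_ofPred_eq] <;> push_cast <;>
          refine ⟨?_, ?_, ?_, ?_⟩ <;> linarith) hconv h
    obtain ⟨h1, h2, h3, h4⟩ := hz
    simp only [drawnAt] at h1 h2 h3 h4
    refine ⟨⟨?_, ?_⟩, ?_, ?_⟩
    all_goals
      rify
      push_cast at *
      linarith
  · rintro ⟨⟨h1, h2⟩, h3, h4⟩
    -- These become the interpolation weights along the two sides, of lengths n - p and p - 1. A
    -- degenerate side has m = 0, where weight 0 is used.
    have hweight : ∀ l m : ℤ, 0 ≤ l → l ≤ m → ∃ s : ℝ, 0 ≤ s ∧ s ≤ 1 ∧ s * m = l := by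
      intro l m hl hm
      by_cases h0 : m = 0
      · obtain rfl : l = 0 := by omega
        exact ⟨0, le_rfl, zero_le_one, by simp⟩
      · have hm0 : (0 : ℝ) < m := by exact_mod_cast (by omega : 0 < m)
        refine ⟨l / m, by positivity, ?_, div_mul_cancel₀ _ hm0.ne'⟩
        rw [div_le_one hm0]
        exact_mod_cast hm
    obtain ⟨s, hs0, hs1, hs⟩ := hweight (q - j - (p - i)) (n - p) (by omega) (by omega)
    obtain ⟨t, ht0, ht1, ht⟩ := hweight (i - j) (p - 1) (by omega) (by omega)
    have hc := convex_convexHull ℝ ({drawnAt p i, drawnAt 1 (i + 1 - p), drawnAt n i,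
      drawnAt (n + 1 - p) (i + 1 - p)} : Set (ℝ × ℝ))
    have hsub := subset_convexHull ℝ ({drawnAt p i, drawnAt 1 (i + 1 - p), drawnAt n i,
      drawnAt (n + 1 - p) (i + 1 - p)} : Set (ℝ × ℝ))
    have e1 := hc (hsub (by simp : drawnAt p i ∈ _)) (hsub (by simp : drawnAt n i ∈ _))
      (sub_nonneg.2 hs1) hs0 (sub_add_cancel 1 s)
    have e2 := hc (hsub (by simp : drawnAt 1 (i + 1 - p) ∈ _))
      (hsub (by simp : drawnAt (n + 1 - p) (i + 1 - p) ∈ _))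
      (sub_nonneg.2 hs1) hs0 (sub_add_cancel 1 s)
    -- Bilinear interpolation: `e1` and `e2` are points at ratio `s` on opposite sides, joined here
    -- at ratio `t`.
    have e3 := hc e1 e2 (sub_nonneg.2 ht1) ht0 (sub_add_cancel 1 t)
    refine (congrArg (· ∈ _) ?_).mp e3
    push_cast at hs ht
    ext
    · simp only [drawnAt, Prod.smul_mk, Prod.mk_add_mk, smul_eq_mul]
      push_cast
      linear_combination hs + ht
    · simp only [drawnAt, Prod.smul_mk, Prod.mk_add_mk, smul_eq_mul]
      push_cast
      linear_combination ht - hs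

end Rectangle

/-! ### Construction and uniqueness of the Serre functor -/

variable (k n) in
/-- The Serre functor on arrows. -/
noncomputable def serrePrefunctor : RepQuiver (LinA n) ⥤q MeshRepA k n where
  obj a := vertex k (serreVertex a)
  map {a b} e :=
    match e with
    | .arr x h => (-1 : k) ^ a.pt.val • arrow k (serreArr x h)
    | .star x h => (-1 : k) ^ (n - b.pt.val) • arrow k (serreStar x h)

theorem serreVertex_tr (b : RepQuiver (LinA n)) :
    serreVertex (RepQuiver.tr b) = RepQuiver.tr (serreVertex b) :=
  vertex_ext rfl (by simp only [serreVertex, RepQuiver.tr, Equiv.coe_fn_mk]; ring)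

variable (k) in
/-- The Serre functor on the morphisms of the path category. -/
noncomputable def pathSerreMap (a b : RepQuiver (LinA n)) :
    (PathCat.vertex k a ⟶ PathCat.vertex k b) →ₗ[k]
      (vertex k (serreVertex a) ⟶ vertex k (serreVertex b)) :=
  PathCat.mapHom (serrePrefunctor k n)

theorem pathSerreMap_comp {a b c : RepQuiver (LinA n)}
    (f : PathCat.vertex k a ⟶ PathCat.vertex k b) (g : PathCat.vertex k b ⟶ PathCat.vertex k c) :
    pathSerreMap k a c (f ≫ g) = pathSerreMap k a b f ≫ pathSerreMap k b c g :=
  PathCat.mapHom_comp _ f g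

theorem pathSerreMap_down {a b : RepQuiver (LinA n)} (h : a.pt.val + 1 = b.pt.val)
    (h' : a.lvl = b.lvl) : pathSerreMap k a b (PathCat.arrow k (down h h')) =
      (-1 : k) ^ a.pt.val • arrow k (serreArr (a := a) (b := b) ⟨h⟩ h') :=
  PathCat.lift_map_arrow (serrePrefunctor k n) (down h h')

theorem pathSerreMap_up {a b : RepQuiver (LinA n)} (h : b.pt.val + 1 = a.pt.val)
    (h' : b.lvl = a.lvl - 1) : pathSerreMap k a b (PathCat.arrow k (up h h')) =
      (-1 : k) ^ (n - b.pt.val) • arrow k (serreStar (a := a) (b := b) ⟨h⟩ h') :=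
  PathCat.lift_map_arrow (serrePrefunctor k n) (up h h')

/-- The reflection q ↦ n + 1 - q exchanges the two halves of a mesh. The signs multiply to (-1)^q
(-1)^(n-q) = (-1)^n, the same as for the other half, so mesh relations go to multiples of mesh
relations. -/
theorem pathSerreMap_meshBelow {b : RepQuiver (LinA n)} (h : b.pt.val < n) :
    ∃ (c : RepQuiver (LinA n)) (f : serreVertex (RepQuiver.tr b) ⟶ c) (g : c ⟶ serreVertex b),
      c.pt.val + 1 = (serreVertex b).pt.val ∧
      pathSerreMap k _ b (meshBelow k b) = (-1 : k) ^ n • (arrow k f ≫ arrow k g) := by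
  refine ⟨serreVertex (predBelow b h), serreArr ⟨by rw [predBelow_pt, tr_pt]⟩
    (by rw [predBelow_lvl, tr_lvl]), serreStar ⟨by rw [predBelow_pt]⟩
    (by rw [predBelow_lvl]; ring), ?_, ?_⟩
  rotate_left
  · rw [meshBelow, dif_pos h, pathSerreMap_comp, toPredBelow, ofPredBelow, pathSerreMap_down,
      pathSerreMap_up, Linear.smul_comp, Linear.comp_smul, smul_smul, ← pow_add,
      show (RepQuiver.tr b).pt.val + (n - b.pt.val) = n from Nat.add_sub_of_le h.le]
  · simp only [serreVertex, LinA.refl, predBelow]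
    omega

theorem pathSerreMap_meshAbove {b : RepQuiver (LinA n)} (h : 1 < b.pt.val) :
    ∃ (c : RepQuiver (LinA n)) (f : serreVertex (RepQuiver.tr b) ⟶ c) (g : c ⟶ serreVertex b),
      c.pt.val = (serreVertex b).pt.val + 1 ∧
      pathSerreMap k _ b (meshAbove k b) = (-1 : k) ^ n • (arrow k f ≫ arrow k g) := by
  have hb := b.pt.le
  refine ⟨serreVertex (predAbove b h), serreStar ⟨by rw [predAbove_pt, tr_pt]⟩
    (by rw [predAbove_lvl, tr_lvl]; ring), serreArr ⟨by rw [predAbove_pt]⟩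
    (by rw [predAbove_lvl]), ?_, ?_⟩
  rotate_left
  · rw [meshAbove, dif_pos h, pathSerreMap_comp, toPredAbove, ofPredAbove, pathSerreMap_down,
      pathSerreMap_up, Linear.smul_comp, Linear.comp_smul, smul_smul, ← pow_add,
      Nat.sub_add_cancel (by have := predAbove_pt b h; omega)]
  · simp only [serreVertex, LinA.refl, predAbove]
    omega

theorem pathSerreMap_meshRelation (b : RepQuiver (LinA n)) :
    pathSerreMap k _ b (meshRelation k b) = 0 := by
  change pathSerreMap k (RepQuiver.tr b) b _ = 0
  rw [meshRelation_eq, map_add]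
  by_cases h1 : b.pt.val < n <;> by_cases h2 : 1 < b.pt.val
  · obtain ⟨c, f, g, hc, e1⟩ := pathSerreMap_meshBelow (k := k) h1
    obtain ⟨d, f', g', hd, e2⟩ := pathSerreMap_meshAbove (k := k) h2
    rw [e1, e2, ← smul_add, add_comm,
      arrow_comp_add_arrow_comp f' g' f g hd hc (serreVertex_tr b), smul_zero]
  -- The vertex `b` has `pt` equal to 1, so its image lies on the border n, where a composite
  -- through the vertex above is already zero.
  · obtain ⟨c, f, g, hc, e1⟩ := pathSerreMap_meshBelow (k := k) h1
    have hb := b.pt.one_le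
    rw [e1, meshAbove, dif_neg h2, arrow_comp_eq_zero_of_eq f g
      (by simp only [serreVertex, LinA.refl]; omega) hc (serreVertex_tr b), smul_zero,
      map_zero, add_zero]
  · obtain ⟨c, f, g, hc, e1⟩ := pathSerreMap_meshAbove (k := k) h2
    have hb := b.pt.le
    rw [e1, meshBelow, dif_neg h1, arrow_comp_eq_zero_of_eq_one f g
      (by simp only [serreVertex, LinA.refl]; omega) hc (serreVertex_tr b), smul_zero,
      map_zero, add_zero]
  · rw [meshBelow, meshAbove, dif_neg h1, dif_neg h2, map_zero, add_zero]

theorem lift_serrePrefunctor_meshRelation (b : RepQuiver (LinA n)) :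
    (PathCat.lift (serrePrefunctor k n)).map (meshRelation k b) = 0 :=
  pathSerreMap_meshRelation b

variable (k n) in
/-- The Serre functor of the mesh category. -/
noncomputable def serreFunctor : MeshRepA k n ⥤ MeshRepA k n :=
  MeshCat.lift (serrePrefunctor k n) lift_serrePrefunctor_meshRelation

instance : (serreFunctor k n).Additive := by
  unfold serreFunctor
  infer_instance

instance : (serreFunctor k n).Linear k := by
  unfold serreFunctor
  infer_instance

variable (k) in
/-- The Serre functor on morphisms between vertices. -/
noncomputable def serreMap (a b : RepQuiver (LinA n)) : (vertex k a ⟶ vertex k b) →ₗ[k]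
    (vertex k (serreVertex a) ⟶ vertex k (serreVertex b)) where
  toFun f := (serreFunctor k n).map f
  map_add' _ _ := (serreFunctor k n).map_add
  map_smul' c f := (serreFunctor k n).map_smul c f

theorem serreMap_id (a : RepQuiver (LinA n)) : serreMap k a a (𝟙 _) = 𝟙 _ :=
  (serreFunctor k n).map_id _

theorem serreMap_comp {a b c : RepQuiver (LinA n)} (f : vertex k a ⟶ vertex k b)
    (g : vertex k b ⟶ vertex k c) :
    serreMap k a c (f ≫ g) = serreMap k a b f ≫ serreMap k b c g :=
  (serreFunctor k n).map_comp f g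

theorem serreMap_down {a b : RepQuiver (LinA n)} (h : a.pt.val + 1 = b.pt.val)
    (h' : a.lvl = b.lvl) : serreMap k a b (arrow k (down h h')) =
      (-1 : k) ^ a.pt.val • arrow k (serreArr (a := a) (b := b) ⟨h⟩ h') :=
  pathSerreMap_down h h'

theorem serreMap_up {a b : RepQuiver (LinA n)} (h : b.pt.val + 1 = a.pt.val)
    (h' : b.lvl = a.lvl - 1) : serreMap k a b (arrow k (up h h')) =
      (-1 : k) ^ (n - b.pt.val) • arrow k (serreStar (a := a) (b := b) ⟨h⟩ h') :=
  pathSerreMap_up h h'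

variable (k n) in
theorem isGivenBySerreFormulas_serreFunctor : IsGivenBySerreFormulas k (serreFunctor k n) where
  obj_eq _ := rfl
  map_arr x h := (serreMap_down x.down h).trans
    ((Category.id_comp _).trans (Category.comp_id _)).symm
  map_star x h := (serreMap_up x.down h).trans
    ((Category.id_comp _).trans (Category.comp_id _)).symm

theorem eq_of_isGivenBySerreFormulas {S S' : MeshRepA k n ⥤ MeshRepA k n} [S.Additive]
    [S.Linear k] [S'.Additive] [S'.Linear k] (hS : IsGivenBySerreFormulas k S)
    (hS' : IsGivenBySerreFormulas k S') : S = S' := by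
  refine MeshCat.functor_ext (k := k) (fun a => (hS.obj_eq a).trans (hS'.obj_eq a).symm) ?_
  rintro a b (⟨x, h⟩ | ⟨x, h⟩)
  · rw [hS.map_arr, hS'.map_arr]
    simp
  · rw [hS.map_star, hS'.map_star]
    simp

/-! ### Serre duality -/

section Serre

/-- The image of `a` is the far corner of its rectangle. Applied twice, this shows that the Serre
functor preserves the relation `InRect`. -/
theorem InRect.serreVertex {a b : RepQuiver (LinA n)} (h : InRect a b) :
    InRect b (serreVertex a) := by
  obtain ⟨⟨h1, h2⟩, h3, h4⟩ := h
  have := a.pt.le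
  refine ⟨⟨?_, ?_⟩, ?_, ?_⟩ <;> simp only [_root_.serreVertex, LinA.refl] <;> omega

theorem InRect.of_serreVertex {a b : RepQuiver (LinA n)} (h : InRect b (_root_.serreVertex a)) :
    InRect a b := by
  obtain ⟨⟨h1, h2⟩, h3, h4⟩ := h
  have := a.pt.le
  simp only [_root_.serreVertex, LinA.refl] at h1 h2 h3 h4
  exact ⟨⟨by omega, by omega⟩, by omega, by omega⟩

variable (k) in
/-- The sign `(-1) ^ (m * (m - 1) / 2)` as a scalar. -/
def triangularSign (m : ℤ) : k := sgn k (m * (m - 1) / 2)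

theorem triangularSign_succ (m : ℤ) :
    triangularSign k (m + 1) = triangularSign k m * sgn k m := by
  rw [triangularSign, triangularSign, ← sgn_add, ← Int.add_mul_ediv_left _ _ two_ne_zero]
  congr 2
  ring

variable (k) in
/-- The sign of the trace on the morphisms from `a` to its image under the Serre functor. -/
def traceSign (a : RepQuiver (LinA n)) : k :=
  triangularSign k (a.pt.val - a.lvl) * triangularSign k (-a.lvl) * sgn k (n * a.lvl)

theorem traceSign_mul_self (a : RepQuiver (LinA n)) : traceSign k a * traceSign k a = 1 := by
  rw [traceSign, triangularSign, triangularSign, ← sgn_add, ← sgn_add, sgn_mul_self]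

/-- This identity dictates `traceSign`: it must change by (-1)^(q-i) along a `down` arrow from (q,
i) and by (-1)^(n+i) along an `up` arrow from level i. The triangular signs in x and in y and the
factor (-1)^(ni) integrate these increments. -/
theorem coeff_serreMap_arrow {a b : RepQuiver (LinA n)} (h : InRect a b) (e : a ⟶ b) :
    coeff _ _ (serreMap k a b (arrow k e)) = traceSign k a * traceSign k b * arrowSign k e := by
  have hS : InRect (serreVertex a) (serreVertex b) := h.serreVertex.serreVertex
  rcases arrow_cases e with ⟨h1, h1', rfl⟩ | ⟨h1, h1', rfl⟩
  · rw [serreMap_down, map_smul, coeff_arrow hS, ← sgn_natCast]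
    have e1 : traceSign k b = traceSign k a * sgn k (a.pt.val - a.lvl) := by
      rw [traceSign, traceSign, ← h1', ← h1]
      push_cast
      rw [show (a.pt.val + 1 - a.lvl : ℤ) = a.pt.val - a.lvl + 1 by ring, triangularSign_succ]
      ring
    rw [e1, ← mul_assoc, traceSign_mul_self, one_mul, arrowSign_down, ← sgn_add, sub_add_cancel]
    exact mul_one _
  · rw [serreMap_up, map_smul, coeff_arrow hS, ← sgn_natCast]
    have ha := a.pt.le
    have e1 : traceSign k b = traceSign k a * sgn k (n + a.lvl) := by
      rw [traceSign, traceSign, h1', ← h1]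
      push_cast
      rw [show (b.pt.val - (a.lvl - 1) : ℤ) = b.pt.val + 1 - a.lvl by ring,
        show (-(a.lvl - 1) : ℤ) = -a.lvl + 1 by ring, triangularSign_succ, sgn_add,
        show ((n : ℤ) * a.lvl) = n * (a.lvl - 1) + n by ring, sgn_add,
        sgn_eq_of_even (k := k) (l := -a.lvl) (m := a.lvl) ⟨-a.lvl, by ring⟩]
      linear_combination (-(triangularSign k (b.pt.val + 1 - a.lvl) * triangularSign k (-a.lvl) *
        sgn k a.lvl * sgn k (n * (a.lvl - 1)))) * sgn_mul_self (k := k) n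
    rw [e1, ← mul_assoc, traceSign_mul_self, one_mul, arrowSign_up, mul_one]
    change sgn k _ * sgn k (a.lvl + 1 - a.pt.val) = _
    rw [← sgn_add]
    refine sgn_eq_of_even ⟨-b.pt.val, ?_⟩
    omega

theorem coeff_serreMap {a b : RepQuiver (LinA n)} (h : InRect a b)
    (f : vertex k a ⟶ vertex k b) :
    coeff _ _ (serreMap k a b f) = traceSign k a * traceSign k b * coeff a b f := by
  induction f using MeshCat.hom_induction with
  | zero => rw [map_zero, map_zero, map_zero, mul_zero]
  | add f g hf hg => rw [map_add, map_add, map_add, mul_add, ← hf, ← hg]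
  | smul c f hf => rw [map_smul, map_smul, map_smul, smul_eq_mul, smul_eq_mul, hf, mul_left_comm]
  | path p =>
    rw [coeff_pathHom h]
    induction p with
    | nil => rw [pathHom_nil, serreMap_id, coeff_id, traceSign_mul_self, pathSign_nil, one_mul]
    | @cons c b p e ih =>
      have h1 := h.left (Reach.of_path p) (Reach.of_arrow e)
      have h2 := h.right (Reach.of_path p) (Reach.of_arrow e)
      rw [pathHom_cons, serreMap_comp, pathSign_cons, coeff_comp h.serreVertex.serreVertex
        h1.serreVertex.serreVertex h2.serreVertex.serreVertex, ih h1, coeff_serreMap_arrow h2]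
      linear_combination (traceSign k a * traceSign k b * pathSign k p * arrowSign k e) *
        traceSign_mul_self (k := k) c

theorem serreMap_bijective (a b : RepQuiver (LinA n)) : Function.Bijective (serreMap k a b) := by
  by_cases h : InRect a b
  · constructor
    · refine (injective_iff_map_eq_zero _).2 fun f hf => eq_zero_of_coeff_eq_zero f ?_
      have e := coeff_serreMap h f
      rw [hf, map_zero] at e
      linear_combination (-(traceSign k a * traceSign k b)) * e -
        coeff a b f * traceSign k b * traceSign k b * traceSign_mul_self (k := k) a -
        coeff a b f * traceSign_mul_self (k := k) b
    · intro g
      obtain ⟨f, hf⟩ := exists_coeff_eq h (traceSign k a * traceSign k b * coeff _ _ g)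
      refine ⟨f, (coeffEquiv h.serreVertex.serreVertex).injective ?_⟩
      change coeff _ _ _ = coeff _ _ g
      rw [coeff_serreMap h, hf]
      linear_combination coeff _ _ g * traceSign k b * traceSign k b *
        traceSign_mul_self (k := k) a + coeff _ _ g * traceSign_mul_self (k := k) b
  · refine ⟨fun f g _ => ?_, fun g => ⟨0, ?_⟩⟩
    · rw [eq_zero_of_not_inRect h f, eq_zero_of_not_inRect h g]
    · rw [eq_zero_of_not_inRect (fun h' => h h'.of_serreVertex.of_serreVertex) g, map_zero]

theorem exists_serreVertex_eq (b : RepQuiver (LinA n)) : ∃ a, serreVertex a = b := by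
  obtain ⟨⟨q, h1, h2⟩, i⟩ := b
  -- The level solves i' + 1 - (n + 1 - q) = i.
  refine ⟨⟨⟨n + 1 - q, by omega, by omega⟩, i + n - q⟩, vertex_ext ?_ ?_⟩ <;>
    simp only [serreVertex, LinA.refl] <;> omega

instance : (serreFunctor k n).Faithful where
  map_injective {X Y} _ _ h := (serreMap_bijective X.as Y.as).injective h

instance : (serreFunctor k n).Full where
  map_surjective {X Y} := (serreMap_bijective X.as Y.as).surjective

instance : (serreFunctor k n).EssSurj where
  mem_essImage Y := by
    obtain ⟨a, ha⟩ := exists_serreVertex_eq (show RepQuiver (LinA n) from Y.as)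
    exact ⟨vertex k a, ⟨eqToIso (congrArg (vertex k) ha)⟩⟩

instance : (serreFunctor k n).IsEquivalence where

/-- The trace on the morphisms from `a` to its image under the Serre functor. -/
noncomputable def trace (a : RepQuiver (LinA n)) :
    (vertex k a ⟶ vertex k (serreVertex a)) →ₗ[k] k :=
  traceSign k a • coeff a (serreVertex a)

theorem trace_comp {a b : RepQuiver (LinA n)} (h : InRect a b) (f : vertex k a ⟶ vertex k b)
    (g : vertex k b ⟶ vertex k (serreVertex a)) :
    trace a (f ≫ g) = traceSign k a * (coeff a b f * coeff b (serreVertex a) g) := by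
  rw [trace, LinearMap.smul_apply, smul_eq_mul,
    coeff_comp (InRect.refl a).serreVertex h h.serreVertex]

/-- Both sides are the product of the coefficients of `f` and `g` up to sign. The factor `traceSign
k b` on the right cancels against the one from `coeff_serreMap`. -/
theorem trace_comp_serreMap {a b : RepQuiver (LinA n)} (f : vertex k a ⟶ vertex k b)
    (g : vertex k b ⟶ vertex k (serreVertex a)) :
    trace a (f ≫ g) = trace b (g ≫ serreMap k a b f) := by
  by_cases h : InRect a b
  · rw [trace_comp h, trace, LinearMap.smul_apply, smul_eq_mul,
      coeff_comp (InRect.refl b).serreVertex h.serreVertex h.serreVertex.serreVertex,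
      coeff_serreMap h]
    linear_combination (-(traceSign k a * coeff a b f * coeff b (serreVertex a) g)) *
      traceSign_mul_self (k := k) b
  · rw [eq_zero_of_not_inRect h f, map_zero, Limits.zero_comp, Limits.comp_zero, map_zero,
      map_zero]

/-- The bilinear form `(f, g) ↦ trace (f ≫ g)`. -/
noncomputable def serreForm (a b : RepQuiver (LinA n)) :
    (vertex k a ⟶ vertex k b) →ₗ[k] Module.Dual k (vertex k b ⟶ vertex k (serreVertex a)) :=
  (Linear.comp (S := k) (vertex k a) (vertex k b) (vertex k (serreVertex a))).compr₂ (trace a)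

theorem serreForm_apply {a b : RepQuiver (LinA n)} (f : vertex k a ⟶ vertex k b)
    (g : vertex k b ⟶ vertex k (serreVertex a)) : serreForm a b f g = trace a (f ≫ g) := rfl

theorem serreForm_bijective (a b : RepQuiver (LinA n)) :
    Function.Bijective (serreForm (k := k) a b) := by
  by_cases h : InRect a b
  -- The morphism `g` generates the second hom-module, so a functional is determined by its value
  -- there, and pairing `f` with `g` gives `traceSign k a` times the coefficient of `f`.
  · obtain ⟨g, hg⟩ := exists_coeff_eq (k := k) h.serreVertex 1
    constructor
    · refine (injective_iff_map_eq_zero _).2 fun f hf => eq_zero_of_coeff_eq_zero f ?_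
      have e := serreForm_apply f g
      rw [hf, trace_comp h, hg, LinearMap.zero_apply] at e
      linear_combination (-traceSign k a) * e - coeff a b f * traceSign_mul_self (k := k) a
    · intro L
      obtain ⟨f, hf⟩ := exists_coeff_eq (k := k) h (traceSign k a * L g)
      refine ⟨f, LinearMap.ext fun g' => ?_⟩
      have e : g' = coeff b (serreVertex a) g' • g := by
        refine (coeffEquiv h.serreVertex).injective ?_
        change coeff _ _ g' = coeff _ _ (_ • g)
        rw [map_smul, hg, smul_eq_mul, mul_one]
      rw [serreForm_apply, trace_comp h, hf]
      conv_rhs => rw [e, map_smul, smul_eq_mul]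
      linear_combination coeff b (serreVertex a) g' * L g * traceSign_mul_self (k := k) a
  · have h' : ¬InRect b (serreVertex a) := fun h' => h h'.of_serreVertex
    constructor
    · intro f f' _
      rw [eq_zero_of_not_inRect h f, eq_zero_of_not_inRect h f']
    · intro L
      refine ⟨0, LinearMap.ext fun g => ?_⟩
      rw [eq_zero_of_not_inRect h' g, map_zero, map_zero]

variable (k n) in
theorem isSerreFunctor_serreFunctor : IsSerreFunctor k (serreFunctor k n) where
  additive := inferInstance
  linear := inferInstance
  isEquivalence := inferInstance
  exists_natIso := by
    refine ⟨fun X Y => LinearEquiv.ofBijective (serreForm X.as Y.as)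
      (serreForm_bijective X.as Y.as), ?_, ?_⟩
    -- Naturality in the second variable is associativity; in the first it is the cyclicity
    -- `trace_comp_serreMap`.
    · intro X Y Z f b g
      exact congrArg (trace (k := k) (show RepQuiver (LinA n) from X.as)) (Category.assoc f b g)
    · intro X' X Y a f g
      refine Eq.trans (congrArg (trace (k := k) (show RepQuiver (LinA n) from X'.as))
        (Category.assoc a f g)) ?_
      refine (trace_comp_serreMap (a := X'.as) (b := X.as) a (f ≫ g)).trans ?_
      exact congrArg (trace (k := k) (show RepQuiver (LinA n) from X.as)) (Category.assoc f g _)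

end Serre

end MeshRepA

theorem theorem7p12 {k : Type w} [CommRing k] [Nontrivial k] (n : ℕ) (hn : 2 ≤ n) :
    HomFinite k (MeshRepA k n) ∧
    LocallyBounded (MeshRepA k n) ∧
    StrongRetractionProperty k (MeshRepA k n) ∧
    (∀ a b : RepQuiver (LinA n),
      (Subsingleton (MeshCat.vertex k a ⟶ MeshCat.vertex k b) ∨
        (Module.Free k (MeshCat.vertex k a ⟶ MeshCat.vertex k b) ∧
          Module.finrank k (MeshCat.vertex k a ⟶ MeshCat.vertex k b) = 1)) ∧
      ((Module.Free k (MeshCat.vertex k a ⟶ MeshCat.vertex k b) ∧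
          Module.finrank k (MeshCat.vertex k a ⟶ MeshCat.vertex k b) = 1) ↔
        drawnAt b.pt.val b.lvl ∈ rectangle n a.pt.val a.lvl)) ∧
    (∃ S : MeshRepA k n ⥤ MeshRepA k n,
      IsSerreFunctor k S ∧ IsGivenBySerreFormulas k S ∧
      ∀ S' : MeshRepA k n ⥤ MeshRepA k n, S'.Additive → S'.Linear k →
        IsGivenBySerreFormulas k S' → S' = S) ∧
    IsPseudoRadical (arrowIdeal k (RepQuiver (LinA n))) ∧
    ((arrowIdeal k (RepQuiver (LinA n))).pow n).IsZero := by
  refine ⟨MeshRepA.homFinite k n, MeshRepA.locallyBounded k n,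
    ⟨_, MeshRepA.isStrongRetractionFamily_bot k n⟩, fun a b => ?_,
    ⟨MeshRepA.serreFunctor k n, MeshRepA.isSerreFunctor_serreFunctor k n,
      MeshRepA.isGivenBySerreFormulas_serreFunctor k n, fun S' _ _ hS' =>
      MeshRepA.eq_of_isGivenBySerreFormulas hS'
        (MeshRepA.isGivenBySerreFormulas_serreFunctor k n)⟩,
    MeshRepA.isPseudoRadical_arrowIdeal k n, MeshRepA.arrowIdeal_pow_isZero k n⟩
  rw [MeshRepA.drawnAt_mem_rectangle_iff]
  exact MeshRepA.subsingleton_or_free k a b
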